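/- **Theorem (Assigning InstaHide images to the original images).** Let $n=n_{\mathsf{priv}}$. A *private selection vector* is a vector in $\{0,1\}^n$ with exactly two entries equal to $1$, and $\mathcal D_{\mathsf{priv}}$ is the uniform distribution on these vectors. Call a matrix $M\in\mathbb Z_{\ge 0}^{m\times m}$ *distinguishable* (with respect to $n$) if there is a matrix $W\in\{0,1\}^{m\times n}$ with exactly two ones in each row and $WW^\top=M$, and this $W$ is unique up to a permutation of its columns (i.e. up to relabelling the $n$ private images). There are an algorithm $\mathcal A$ (AssigningOriginalImages), namely a single program for a unit-cost word RAM, and a constant $K$ with the following properties. The input of $\mathcal A$ consists of $n$, $m$ and random access to the entries of an $m\times m$ matrix $M$; reading one entry costs one step, and the time for loading all of $M$ into memory is not counted. 1. *(Running time.)* For all $m\ge 1$, all $n$ and every $W\in\{0,1\}^{m\times n}$ with exactly two ones in each row, $\mathcal A$ on input $(WW^\top,n)$ halts after at most $K\,m\,n$ steps, i.e. it runs in time $O(mn)$, and all numbers that it stores are at most $(mn)^K$, i.e. its words have $O(\log(mn))$ bits. 2. *(Recovery with high probability.)* For every $c>0$ there is $C>0$ such that for all $n\ge 5$ and all $m\ge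 C\,n\log n$: if the rows of $W_{\mathsf{priv}}\in\{0,1\}^{m\times n}$ are independent samples from $\mathcal D_{\mathsf{priv}}$ and $M_{\mathsf{priv}}=W_{\mathsf{priv}}W_{\mathsf{priv}}^\top\in\{0,1,2\}^{m\times m}$, then with probability at least $1-n^{-c}$ both of the following hold: $M_{\mathsf{priv}}$ is distinguishable, and $\mathcal A$ on input $(M_{\mathsf{priv}},n)$ outputs a matrix $W\in\{0,1\}^{m\times n}$ with exactly two ones in each row and $WW^\top=M_{\mathsf{priv}}$ (so $W$ equals $W_{\mathsf{priv}}$ up to a permutation of columns). -/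

import Mathlib

/-! Selection vectors, private Gram matrices, and a word RAM with random access to an input matrix. -/

namespace InstaHide

open MeasureTheory

/-- The support of the distribution of private selection vectors with sparsity `2`:
the `0/1` vectors indexed by the `n` private images with exactly two entries equal to `1`. -/
def privSupport (n : ℕ) : Set (Fin n → ℕ) :=
  {w | ∃ T : Finset (Fin n), T.card = 2 ∧ w = fun j => if j ∈ T then 1 else 0}

/-- The distribution of a private selection vector: the indicator vector of a uniformly random
`2`-element subset of the `n` private images. -/
noncomputable def privDist (n : ℕ) : Measure (Fin n → ℕ) :=
  ProbabilityTheory.uniformOn (privSupport n)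

/-- The law of `(w_1, …, w_m)`, with the `w_i` independent and distributed as `privDist n`. -/
noncomputable def sampleLaw (m n : ℕ) : Measure (Fin m → Fin n → ℕ) :=
  Measure.pi fun _ => privDist n

/-- All rows of `W` are private selection vectors. -/
def IsMixup {m n : ℕ} (W : Matrix (Fin m) (Fin n) ℕ) : Prop :=
  ∀ i, W i ∈ privSupport n

/-- The private Gram matrix `W Wᵀ`. -/
def privGram {m n : ℕ} (W : Matrix (Fin m) (Fin n) ℕ) : Matrix (Fin m) (Fin m) ℕ :=
  W * W.transpose

/-- `M` is distinguishable: `W Wᵀ = M` has a solution whose rows are private selection vectors of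
length `n`, and this solution is unique up to a permutation of the columns (that is, up to a
relabelling of the `n` private images). -/
def Distinguishable {m : ℕ} (n : ℕ) (M : Matrix (Fin m) (Fin m) ℕ) : Prop :=
  (∃ W : Matrix (Fin m) (Fin n) ℕ, IsMixup W ∧ privGram W = M) ∧
    ∀ W W' : Matrix (Fin m) (Fin n) ℕ, IsMixup W → privGram W = M → IsMixup W' → privGram W' = M →
      ∃ σ : Equiv.Perm (Fin n), W' = W.submatrix id σ

/-- Instructions of the RAM. Operands are addresses of memory cells, except for the number `k` in
`const` and the jump target `l`. -/
inductive Instr : Type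
  /-- `mem[d] := k` -/
  | const (d k : ℕ)
  /-- `mem[d] := mem[a] + mem[b]` -/
  | add (d a b : ℕ)
  /-- `mem[d] := mem[a] - mem[b]` (truncated at `0`) -/
  | sub (d a b : ℕ)
  /-- `mem[d] := mem[a] * mem[b]` -/
  | mul (d a b : ℕ)
  /-- `mem[d] := mem[mem[a]]` -/
  | load (d a : ℕ)
  /-- `mem[mem[a]] := mem[b]` -/
  | store (a b : ℕ)
  /-- `mem[d] :=` the entry of the input matrix in row `mem[a]` and column `mem[b]` -/
  | query (d a b : ℕ)
  /-- jump to instruction `l` if `mem[a] < mem[b]` -/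
  | jumpLt (a b l : ℕ)

/-- A program is a finite list of instructions; it halts when the program counter leaves the
list. -/
abbrev Program : Type := List Instr

/-- A configuration: program counter and memory. -/
structure Config where
  pc : ℕ
  mem : ℕ → ℕ

/-- The entry `(i, j)` of the input matrix, `0` outside its index range. -/
def entry {m : ℕ} (M : Matrix (Fin m) (Fin m) ℕ) (i j : ℕ) : ℕ :=
  if h : i < m ∧ j < m then M ⟨i, h.1⟩ ⟨j, h.2⟩ else 0

/-- The memory `mem` after writing `v` at address `d`. -/
def write (mem : ℕ → ℕ) (d v : ℕ) : ℕ → ℕ :=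
  fun x => if x = d then v else mem x

/-- Execution of one instruction on the input matrix `M`. -/
def exec {m : ℕ} (M : Matrix (Fin m) (Fin m) ℕ) (c : Config) : Instr → Config
  | .const d k => ⟨c.pc + 1, write c.mem d k⟩
  | .add d a b => ⟨c.pc + 1, write c.mem d (c.mem a + c.mem b)⟩
  | .sub d a b => ⟨c.pc + 1, write c.mem d (c.mem a - c.mem b)⟩
  | .mul d a b => ⟨c.pc + 1, write c.mem d (c.mem a * c.mem b)⟩
  | .load d a => ⟨c.pc + 1, write c.mem d (c.mem (c.mem a))⟩
  | .store a b => ⟨c.pc + 1, write c.mem (c.mem a) (c.mem b)⟩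
  | .query d a b => ⟨c.pc + 1, write c.mem d (entry M (c.mem a) (c.mem b))⟩
  | .jumpLt a b l => ⟨if c.mem a < c.mem b then l else c.pc + 1, c.mem⟩

/-- One step of the program `P`; a halted configuration does not change. -/
def step {m : ℕ} (P : Program) (M : Matrix (Fin m) (Fin m) ℕ) (c : Config) : Config :=
  match P[c.pc]? with
  | some ins => exec M c ins
  | none => c

/-- The initial configuration: cell `0` holds `m`, cell `1` holds `n`, all other cells hold `0`.
The matrix is not copied into memory; it is accessed by `query`. -/
def init (m n : ℕ) : Config :=
  ⟨0, fun x => if x = 0 then m else if x = 1 then n else 0⟩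

/-- The configuration of `P` after `t` steps on the input `(M, n)`. -/
def run {m : ℕ} (P : Program) (M : Matrix (Fin m) (Fin m) ℕ) (n t : ℕ) : Config :=
  (step P M)^[t] (init m n)

/-- On the input `(M, n)`, the program `P` has halted after at most `T` steps, and every memory
cell holds a number at most `B` at all times. -/
def HaltsWithin {m : ℕ} (P : Program) (M : Matrix (Fin m) (Fin m) ℕ) (n T B : ℕ) : Prop :=
  P.length ≤ (run P M n T).pc ∧ ∀ t a, (run P M n t).mem a ≤ B

/-- The `m × n` matrix stored in memory in row-major order, starting at the address held by
cell `0`. -/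
def outputMatrix (m n : ℕ) (c : Config) : Matrix (Fin m) (Fin n) ℕ :=
  Matrix.of fun i j => c.mem (c.mem 0 + i * n + j)

end InstaHide

/-!
A matrix whose rows are private selection vectors is the incidence matrix of a multigraph: the
vertices are the private images, the edges are the rows, and `M i f` is the number of common
endpoints of the edges `i` and `f`. Recovering `W` from `W Wᵀ` means recovering a multigraph from
the intersection pattern of its edges.

The sample is good if every vertex has four distinct neighbours (`HasFourNeighbours`) and the
multigraph is connected (`IsConn`). For `m ≥ C n log n` this fails with probability at most
`n ^ (-c)` by a union bound (`sampleLaw_not_isGood_le`): both conditions say that the sample hits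
certain complete bipartite sets of edges, and the cuts are summed by
`∑ q ^ |S| = (1 + q) ^ n` over all sets `S` of vertices.

Four edges that pairwise share exactly one endpoint form a star (`exists_common_of_four`), and an
edge contains the centre of a star if and only if it meets three of its edges
(`mem_of_meets_three`). So a star is visible in `M`, and three of its rows determine the column of
its centre. Hence four neighbours at every vertex make `M` distinguishable
(`distinguishable_of_hasFourNeighbours`).

The algorithm finds one column in this way (`seed_column`). After that, an edge `i` with exactly
one endpoint `u` known yields the column of its other endpoint as the difference of row `i` of `M`
and column `u` (`propagate`), and by connectivity such an edge exists until all `n` columns are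
known (`exists_knownCount_eq_one`). To find such an edge, the program keeps for each edge the number of
its known endpoints and the sum of their indices; each column costs `O(m)` steps, so that the whole
computation costs `O(mn)` steps. The program consists of counting loops with branch-free bodies, so
that the bounds on time and memory hold for every `W`, good or not (`program_correct`).
-/

namespace InstaHide

/-! ### Executions of straight-line code and of loops -/

/-- On the input matrix `M`, the program `P` passes from program counter `pc` and memory `s` to
program counter `pc'` and memory `s'` in at most `T` steps, and all numbers stored on the way,
both ends included, are at most `B`. -/
def Runs {m : ℕ} (P : Program) (M : Matrix (Fin m) (Fin m) ℕ) (B T pc : ℕ) (s : ℕ → ℕ)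
    (pc' : ℕ) (s' : ℕ → ℕ) : Prop :=
  ∃ t ≤ T, (step P M)^[t] ⟨pc, s⟩ = ⟨pc', s'⟩ ∧
    ∀ r ≤ t, ∀ a, ((step P M)^[r] ⟨pc, s⟩).mem a ≤ B

/-- The address written by an instruction; immaterial for `jumpLt`. -/
def target (s : ℕ → ℕ) : Instr → ℕ
  | .const d _ => d
  | .add d _ _ => d
  | .sub d _ _ => d
  | .mul d _ _ => d
  | .load d _ => d
  | .store a _ => s a
  | .query d _ _ => d
  | .jumpLt _ _ _ => 0

/-- The value written by an instruction; immaterial for `jumpLt`. -/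
def value {m : ℕ} (M : Matrix (Fin m) (Fin m) ℕ) (s : ℕ → ℕ) : Instr → ℕ
  | .const _ k => k
  | .add _ a b => s a + s b
  | .sub _ a b => s a - s b
  | .mul _ a b => s a * s b
  | .load _ a => s (s a)
  | .store _ b => s b
  | .query _ a b => entry M (s a) (s b)
  | .jumpLt _ _ _ => 0

/-- The instruction is not a jump. -/
def IsStraight : Instr → Prop
  | .jumpLt _ _ _ => False
  | _ => True

/-- The weakest precondition of a straight-line block: all numbers it writes are at most `B`, and
the memory after the block satisfies `Q`. -/
def wp {m : ℕ} (M : Matrix (Fin m) (Fin m) ℕ) (B : ℕ) (Q : (ℕ → ℕ) → Prop) :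
    List Instr → (ℕ → ℕ) → Prop
  | [], s => Q s
  | ins :: l, s =>
    IsStraight ins ∧ value M s ins ≤ B ∧ wp M B Q l (write s (target s ins) (value M s ins))

section Executions

variable {m : ℕ} {P : Program} {M : Matrix (Fin m) (Fin m) ℕ} {B : ℕ}

theorem Runs.refl {pc : ℕ} {s : ℕ → ℕ} (h : ∀ a, s a ≤ B) (T : ℕ) : Runs P M B T pc s pc s :=
  ⟨0, Nat.zero_le _, rfl, fun r hr a => by
    obtain rfl : r = 0 := by omega
    exact h a⟩

theorem Runs.mono {T T' pc pc' : ℕ} {s s' : ℕ → ℕ} (h : Runs P M B T pc s pc' s') (hT : T ≤ T') :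
    Runs P M B T' pc s pc' s' := by
  obtain ⟨t, ht, h⟩ := h
  exact ⟨t, ht.trans hT, h⟩

theorem Runs.trans {T T' pc pc' pc'' : ℕ} {s s' s'' : ℕ → ℕ} (h : Runs P M B T pc s pc' s')
    (h' : Runs P M B T' pc' s' pc'' s'') : Runs P M B (T + T') pc s pc'' s'' := by
  obtain ⟨t, ht, he, hb⟩ := h
  obtain ⟨t', ht', he', hb'⟩ := h'
  refine ⟨t + t', by omega, ?_, fun r hr a => ?_⟩
  · rw [Nat.add_comm, Function.iterate_add_apply, he, he']
  · rcases le_total r t with hrt | hrt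
    · exact hb r hrt a
    · obtain ⟨q, rfl⟩ := Nat.exists_eq_add_of_le hrt
      rw [Nat.add_comm, Function.iterate_add_apply, he]
      exact hb' q (by omega) a

theorem Runs.bound_final {T pc pc' : ℕ} {s s' : ℕ → ℕ} (h : Runs P M B T pc s pc' s') (a : ℕ) :
    s' a ≤ B := by
  obtain ⟨t, ht, he, hb⟩ := h
  simpa [he] using hb t le_rfl a

theorem runs_step {pc : ℕ} {s : ℕ → ℕ} {ins : Instr} {c : Config} (hP : P[pc]? = some ins)
    (hc : exec M ⟨pc, s⟩ ins = c) (hs : ∀ a, s a ≤ B) (hs' : ∀ a, c.mem a ≤ B) :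
    Runs P M B 1 pc s c.pc c.mem := by
  have h1 : step P M ⟨pc, s⟩ = c := by simp [step, hP, hc]
  refine ⟨1, le_rfl, by simpa using h1, fun r hr a => ?_⟩
  interval_cases r
  · exact hs a
  · simpa [h1] using hs' a

theorem write_le {s : ℕ → ℕ} {d v : ℕ} (hs : ∀ a, s a ≤ B) (hv : v ≤ B) (a : ℕ) :
    write s d v a ≤ B := by
  unfold write
  split_ifs
  exacts [hv, hs a]

theorem exec_of_isStraight {pc : ℕ} {s : ℕ → ℕ} {ins : Instr} (h : IsStraight ins) :
    exec M ⟨pc, s⟩ ins = ⟨pc + 1, write s (target s ins) (value M s ins)⟩ := by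
  cases ins <;> first | rfl | exact h.elim

/-- A straight-line block that is part of the program can be executed whenever its weakest
precondition holds. -/
theorem runs_block {Q : (ℕ → ℕ) → Prop} (l : List Instr) {pc : ℕ} {s : ℕ → ℕ}
    (hP : l <+: P.drop pc) (hs : ∀ a, s a ≤ B) (h : wp M B Q l s) :
    ∃ s', Runs P M B l.length pc s (pc + l.length) s' ∧ Q s' := by
  induction l generalizing pc s with
  | nil => exact ⟨s, Runs.refl hs _, h⟩
  | cons ins l ih =>
    obtain ⟨tl, htl⟩ := hP
    obtain ⟨h1, h2, h3⟩ := h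
    have hget : P[pc]? = some ins := by
      have := congrArg (fun x : List Instr => x[0]?) htl
      simpa using this.symm
    have hdrop : l <+: P.drop (pc + 1) := by
      refine ⟨tl, ?_⟩
      have := congrArg List.tail htl
      simpa using this
    have hb := write_le (d := target s ins) hs h2
    obtain ⟨s', hr, hq⟩ := ih hdrop hb h3
    refine ⟨s', ?_, hq⟩
    have := (runs_step (M := M) hget (exec_of_isStraight h1) hs hb).trans hr
    simpa [Nat.add_comm, Nat.add_left_comm] using this

/-- The rule for a loop `do body while s a < s b` with `N ≥ 1` rounds and invariant `I`. -/
theorem runs_loop {I : ℕ → (ℕ → ℕ) → Prop} {N T pc q a b : ℕ} {s : ℕ → ℕ} (hN : 0 < N)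
    (hP : P[q]? = some (.jumpLt a b pc))
    (body : ∀ t < N, ∀ s, (∀ x, s x ≤ B) → I t s →
      ∃ s', Runs P M B T pc s q s' ∧ I (t + 1) s' ∧ (s' a < s' b ↔ t + 1 < N))
    (hs : ∀ x, s x ≤ B) (h0 : I 0 s) :
    ∃ s', Runs P M B (N * (T + 1)) pc s (q + 1) s' ∧ I N s' := by
  suffices H : ∀ r t s, t + (r + 1) = N → (∀ x, s x ≤ B) → I t s →
      ∃ s', Runs P M B ((r + 1) * (T + 1)) pc s (q + 1) s' ∧ I N s' by
    obtain ⟨r, rfl⟩ : ∃ r, N = r + 1 := ⟨N - 1, by omega⟩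
    exact H r 0 s (by omega) hs h0
  intro r
  induction r with
  | zero =>
    intro t s ht hs hI
    obtain ⟨s', hr, hI', hlt⟩ := body t (by omega) s hs hI
    refine ⟨s', ?_, by rwa [← ht]⟩
    have hj : exec M ⟨q, s'⟩ (.jumpLt a b pc) = ⟨q + 1, s'⟩ := by
      have : ¬ s' a < s' b := by rw [hlt]; omega
      simp [exec, this]
    simpa using hr.trans (runs_step hP hj hr.bound_final hr.bound_final)
  | succ r ih =>
    intro t s ht hs hI
    obtain ⟨s', hr, hI', hlt⟩ := body t (by omega) s hs hI
    have hj : exec M ⟨q, s'⟩ (.jumpLt a b pc) = ⟨pc, s'⟩ := by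
      have : s' a < s' b := by rw [hlt]; omega
      simp [exec, this]
    obtain ⟨s'', hr'', hI''⟩ := ih (t + 1) s' (by omega) hr.bound_final hI'
    refine ⟨s'', ?_, hI''⟩
    refine ((hr.trans (runs_step hP hj hr.bound_final hr.bound_final)).trans hr'').mono ?_
    exact le_of_eq (by ring)

/-- A run from the initial configuration to the end of the program bounds time and memory for good,
since a halted configuration does not change. -/
theorem Runs.haltsWithin {n T : ℕ} {s' : ℕ → ℕ}
    (h : Runs P M B T 0 (init m n).mem P.length s') :
    HaltsWithin P M n T B ∧ (run P M n T).mem = s' := by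
  obtain ⟨t, ht, he, hb⟩ := h
  have hfix : step P M ⟨P.length, s'⟩ = ⟨P.length, s'⟩ := by simp [step]
  have hrun : ∀ r, t ≤ r → run P M n r = ⟨P.length, s'⟩ := by
    intro r hr
    obtain ⟨q, rfl⟩ := Nat.exists_eq_add_of_le hr
    unfold run
    rw [Nat.add_comm, Function.iterate_add_apply]
    change (step P M)^[q] ((step P M)^[t] ⟨0, (init m n).mem⟩) = _
    rw [he]
    exact Function.iterate_fixed hfix q
  refine ⟨⟨by rw [hrun T ht], fun r a => ?_⟩, by rw [hrun T ht]⟩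
  rcases le_total r t with h | h
  · exact hb r h a
  · rw [hrun r h]
    have := hb t le_rfl a
    rwa [he] at this

end Executions

/-! ### Stars in the intersection pattern of two-element sets -/

section Stars

variable {α : Type*} [DecidableEq α]

theorem card_inter_pair_pair {v a b : α} (hab : a ≠ b) :
    (({v, a} : Finset α) ∩ {v, b}).card = 1 := by
  have : (({v, a} : Finset α) ∩ {v, b}) = {v} := by
    ext x
    simp only [Finset.mem_inter, Finset.mem_insert, Finset.mem_singleton]
    grind
  simp [this]

theorem exists_eq_pair {A : Finset α} (hA : A.card = 2) {v : α} (hv : v ∈ A) :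
    ∃ a, v ≠ a ∧ A = {v, a} := by
  obtain ⟨x, y, hxy, rfl⟩ := Finset.card_eq_two.1 hA
  simp only [Finset.mem_insert, Finset.mem_singleton] at hv
  rcases hv with rfl | rfl
  exacts [⟨y, hxy, rfl⟩, ⟨x, hxy.symm, Finset.pair_comm _ _⟩]

theorem one_le_card_inter_iff {A B : Finset α} :
    1 ≤ (A ∩ B).card ↔ ∃ x ∈ A, x ∈ B := by
  simp [Finset.one_le_card, Finset.Nonempty]

theorem exists_pair_of_card_inter {A B : Finset α} (hA : A.card = 2) (hB : B.card = 2)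
    (h : (A ∩ B).card = 1) :
    ∃ v a b, v ≠ a ∧ v ≠ b ∧ a ≠ b ∧ A = {v, a} ∧ B = {v, b} := by
  obtain ⟨v, hv⟩ := Finset.card_pos.1 (by omega : 0 < (A ∩ B).card)
  obtain ⟨hvA, hvB⟩ := Finset.mem_inter.1 hv
  obtain ⟨a, ha, rfl⟩ := exists_eq_pair hA hvA
  obtain ⟨b, hb, rfl⟩ := exists_eq_pair hB hvB
  refine ⟨v, a, b, ha, hb, ?_, rfl, rfl⟩
  rintro rfl
  simp [hA] at h

/-- Three distinct edges at `v` meet an edge `F` only if `F` contains `v`, since otherwise `F` would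
contain the three other endpoints. -/
theorem mem_of_meets_three {A B C F : Finset α} {v : α} (hA : A.card = 2) (hB : B.card = 2)
    (hC : C.card = 2) (hF : F.card ≤ 2) (hvA : v ∈ A) (hvB : v ∈ B) (hvC : v ∈ C)
    (hAB : (A ∩ B).card = 1) (hAC : (A ∩ C).card = 1) (hBC : (B ∩ C).card = 1)
    (hFA : 1 ≤ (A ∩ F).card) (hFB : 1 ≤ (B ∩ F).card) (hFC : 1 ≤ (C ∩ F).card) : v ∈ F := by
  obtain ⟨a, ha, rfl⟩ := exists_eq_pair hA hvA
  obtain ⟨b, hb, rfl⟩ := exists_eq_pair hB hvB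
  obtain ⟨c, hc, rfl⟩ := exists_eq_pair hC hvC
  have hab : a ≠ b := by rintro rfl; simp [hA] at hAB
  have hac : a ≠ c := by rintro rfl; simp [hA] at hAC
  have hbc : b ≠ c := by rintro rfl; simp [hB] at hBC
  rw [one_le_card_inter_iff] at hFA hFB hFC
  by_contra hv
  have haF : a ∈ F := by grind
  have hbF : b ∈ F := by grind
  have hcF : c ∈ F := by grind
  have : ({a, b, c} : Finset α).card ≤ F.card := Finset.card_le_card (by grind)
  rw [Finset.card_eq_three.2 ⟨a, b, c, hab, hac, hbc, rfl⟩] at this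
  omega

/-- Four distinct, pairwise intersecting edges have a common endpoint: pairwise intersecting edges
form a star or a triangle, and a triangle has only three edges. -/
theorem exists_common_of_four {A B C D : Finset α} (hA : A.card = 2) (hB : B.card = 2)
    (hC : C.card = 2) (hD : D.card = 2) (hAB : (A ∩ B).card = 1) (hAC : (A ∩ C).card = 1)
    (hAD : (A ∩ D).card = 1) (hBC : (B ∩ C).card = 1) (hBD : (B ∩ D).card = 1)
    (hCD : (C ∩ D).card = 1) : ∃ v, v ∈ A ∧ v ∈ B ∧ v ∈ C ∧ v ∈ D := by
  obtain ⟨v, a, b, hva, hvb, hab, rfl, rfl⟩ := exists_pair_of_card_inter hA hB hAB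
  -- An edge that avoids `v` but meets both `{v, a}` and `{v, b}` is `{a, b}`.
  have key : ∀ F : Finset α, F.card = 2 → (({v, a} : Finset α) ∩ F).card = 1 →
      (({v, b} : Finset α) ∩ F).card = 1 → v ∉ F → F = {a, b} := by
    intro F hF h1 h2 hv
    have h1 := one_le_card_inter_iff.1 h1.ge
    have h2 := one_le_card_inter_iff.1 h2.ge
    refine (Finset.eq_of_subset_of_card_le ?_ ?_).symm
    · grind
    · rw [hF, Finset.card_pair hab]
  have key' : ∀ F : Finset α, F.card = 2 → (({v, a} : Finset α) ∩ F).card = 1 →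
      (({v, b} : Finset α) ∩ F).card = 1 → (({a, b} : Finset α) ∩ F).card = 1 → v ∈ F → False := by
    intro F hF h1 h2 h3 hv
    obtain ⟨c, hc, rfl⟩ := exists_eq_pair hF hv
    have h3 := one_le_card_inter_iff.1 h3.ge
    have : c = a ∨ c = b := by grind
    rcases this with rfl | rfl
    · simp [hA] at h1
    · simp [hB] at h2
  by_cases hvC : v ∈ C <;> by_cases hvD : v ∈ D
  · exact ⟨v, by simp, by simp, hvC, hvD⟩
  · have := key D hD hAD hBD hvD
    subst this
    exact (key' C hC hAC hBC (by rwa [Finset.inter_comm]) hvC).elim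
  · have := key C hC hAC hBC hvC
    subst this
    exact (key' D hD hAD hBD hCD hvD).elim
  · have h1 := key C hC hAC hBC hvC
    have h2 := key D hD hAD hBD hvD
    subst h1
    subst h2
    simp [hC] at hCD

end Stars

/-! ### Selection matrices as multigraphs -/

/-- The family `e 0, …, e (m - 1)` lists the edges of a multigraph on `n` vertices, and `e i = ∅`
for `i ≥ m`. Edges are indexed by all of `ℕ` to match the total function `entry`. -/
structure IsEdgeList {n : ℕ} (m : ℕ) (e : ℕ → Finset (Fin n)) : Prop where
  card_eq : ∀ i < m, (e i).card = 2
  eq_empty : ∀ i, m ≤ i → e i = ∅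

/-- `W` is the edge-vertex incidence matrix of the multigraph with edges `e 0, …, e (m - 1)`. -/
def IsIncidence {m n : ℕ} (W : Matrix (Fin m) (Fin n) ℕ) (e : ℕ → Finset (Fin n)) : Prop :=
  ∀ (i : Fin m) (j : Fin n), W i j = if j ∈ e i then 1 else 0

theorem IsMixup.exists_edges {m n : ℕ} {W : Matrix (Fin m) (Fin n) ℕ} (h : IsMixup W) :
    ∃ e : ℕ → Finset (Fin n), IsEdgeList m e ∧ IsIncidence W e := by
  choose T hT hW using h
  refine ⟨fun i => if h : i < m then T ⟨i, h⟩ else ∅, ⟨fun i hi => ?_, fun i hi => ?_⟩, ?_⟩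
  · simp [hi, hT]
  · simp [Nat.not_lt.2 hi]
  · intro i j
    simp [hW i]

theorem entry_privGram {m n : ℕ} {W : Matrix (Fin m) (Fin n) ℕ} {e : ℕ → Finset (Fin n)}
    (he : IsEdgeList m e) (hW : IsIncidence W e) (i f : ℕ) :
    entry (privGram W) i f = (e i ∩ e f).card := by
  unfold entry
  split_ifs with h
  · have : (e i ∩ e f).card = ∑ j, if j ∈ e i ∩ e f then 1 else 0 := by
      rw [← Finset.card_filter]
      congr 1
      ext
      simp
    rw [this]
    simp only [privGram, Matrix.mul_apply, Matrix.transpose_apply, hW _ _, Finset.mem_inter]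
    refine Finset.sum_congr rfl fun j _ => ?_
    by_cases h1 : j ∈ e i <;> by_cases h2 : j ∈ e f <;> simp [h1, h2]
  · rw [not_and_or, not_lt, not_lt] at h
    rcases h with h | h <;> simp [he.eq_empty _ h]

theorem IsEdgeList.lt_of_mem {m n : ℕ} {e : ℕ → Finset (Fin n)} (he : IsEdgeList m e) {i : ℕ}
    {v : Fin n} (h : v ∈ e i) : i < m := by
  by_contra hi
  simp [he.eq_empty i (not_lt.1 hi)] at h

theorem IsEdgeList.card_le {m n : ℕ} {e : ℕ → Finset (Fin n)} (he : IsEdgeList m e) (i : ℕ) :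
    (e i).card ≤ 2 := by
  rcases lt_or_ge i m with hi | hi
  · exact (he.card_eq i hi).le
  · simp [he.eq_empty i hi]

theorem IsEdgeList.lt_of_inter {m n : ℕ} {e : ℕ → Finset (Fin n)} (he : IsEdgeList m e) {i f : ℕ}
    (h : 1 ≤ (e i ∩ e f).card) : i < m ∧ f < m := by
  obtain ⟨x, hx, hy⟩ := one_le_card_inter_iff.1 h
  exact ⟨he.lt_of_mem hx, he.lt_of_mem hy⟩

/-- Every vertex has a neighbour outside any set of three vertices. Equivalently, every vertex has
at least four distinct neighbours. -/
def HasFourNeighbours {n : ℕ} (m : ℕ) (e : ℕ → Finset (Fin n)) : Prop :=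
  ∀ v a b c : Fin n, ∃ i < m, ∃ w, w ≠ v ∧ w ≠ a ∧ w ≠ b ∧ w ≠ c ∧ e i = {v, w}

/-- The multigraph is connected: some edge leaves every nonempty proper set of vertices. -/
def IsConn {n : ℕ} (m : ℕ) (e : ℕ → Finset (Fin n)) : Prop :=
  ∀ S : Finset (Fin n), S.Nonempty → S ≠ Finset.univ → ∃ i < m, ∃ u ∈ S, ∃ w ∉ S, e i = {u, w}

/-- At every vertex of a multigraph with four neighbours per vertex there are four pairwise distinct
edges. -/
theorem HasFourNeighbours.exists_star {m n : ℕ} {e : ℕ → Finset (Fin n)}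
    (h : HasFourNeighbours m e) (v : Fin n) :
    ∃ i₁ i₂ i₃ i₄, (i₁ < m ∧ i₂ < m ∧ i₃ < m ∧ i₄ < m) ∧
      (v ∈ e i₁ ∧ v ∈ e i₂ ∧ v ∈ e i₃ ∧ v ∈ e i₄) ∧
      (e i₁ ∩ e i₂).card = 1 ∧ (e i₁ ∩ e i₃).card = 1 ∧ (e i₁ ∩ e i₄).card = 1 ∧
      (e i₂ ∩ e i₃).card = 1 ∧ (e i₂ ∩ e i₄).card = 1 ∧ (e i₃ ∩ e i₄).card = 1 := by
  obtain ⟨i₁, h1, w₁, hv1, -, -, -, e1⟩ := h v v v v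
  obtain ⟨i₂, h2, w₂, hv2, h12, -, -, e2⟩ := h v w₁ v v
  obtain ⟨i₃, h3, w₃, hv3, h13, h23, -, e3⟩ := h v w₁ w₂ v
  obtain ⟨i₄, h4, w₄, hv4, h14, h24, h34, e4⟩ := h v w₁ w₂ w₃
  refine ⟨i₁, i₂, i₃, i₄, ⟨h1, h2, h3, h4⟩, by simp [e1, e2, e3, e4], ?_⟩
  rw [e1, e2, e3, e4]
  refine ⟨?_, ?_, ?_, ?_, ?_, ?_⟩ <;> apply card_inter_pair_pair <;>
    first | assumption | (symm; assumption)

/-- If every vertex has four neighbours, then the Gram matrix determines the incidence matrix up to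
a permutation of the columns. A star of four edges at `v` is recognized by its pairwise entries `1`,
hence is a star in every other solution, and three of its rows determine the column of `v`. -/
theorem distinguishable_of_hasFourNeighbours {m n : ℕ} {W : Matrix (Fin m) (Fin n) ℕ}
    {e : ℕ → Finset (Fin n)} (he : IsEdgeList m e) (hW : IsIncidence W e) (hmix : IsMixup W)
    (h : HasFourNeighbours m e) : Distinguishable n (privGram W) := by
  have key : ∀ W' : Matrix (Fin m) (Fin n) ℕ, IsMixup W' → privGram W' = privGram W →
      ∃ σ : Equiv.Perm (Fin n), W = W'.submatrix id σ := by
    intro W' hmix' hgram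
    obtain ⟨e', he', hW'⟩ := hmix'.exists_edges
    have hcard : ∀ i f, (e' i ∩ e' f).card = (e i ∩ e f).card := fun i f => by
      rw [← entry_privGram he hW, ← entry_privGram he' hW', hgram]
    have hφ : ∀ v, ∃ v', ∀ f < m, v ∈ e f ↔ v' ∈ e' f := by
      intro v
      obtain ⟨i₁, i₂, i₃, i₄, ⟨h1, h2, h3, h4⟩, ⟨m1, m2, m3, m4⟩, h12, h13, h14, h23, h24, h34⟩ :=
        h.exists_star v
      have c := he.card_eq
      have c' := he'.card_eq
      obtain ⟨v', n1, n2, n3, n4⟩ := exists_common_of_four (c' _ h1) (c' _ h2) (c' _ h3) (c' _ h4)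
        (by rwa [hcard]) (by rwa [hcard]) (by rwa [hcard]) (by rwa [hcard]) (by rwa [hcard])
        (by rwa [hcard])
      refine ⟨v', fun f hf => ⟨fun hv => ?_, fun hv => ?_⟩⟩
      · refine mem_of_meets_three (c' _ h1) (c' _ h2) (c' _ h3) (c' f hf).le n1 n2 n3
          (by rwa [hcard]) (by rwa [hcard]) (by rwa [hcard]) ?_ ?_ ?_ <;> rw [hcard] <;>
          exact one_le_card_inter_iff.2 ⟨v, by assumption, hv⟩
      · refine mem_of_meets_three (c _ h1) (c _ h2) (c _ h3) (c f hf).le m1 m2 m3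
          h12 h13 h23 ?_ ?_ ?_ <;> rw [← hcard] <;>
          exact one_le_card_inter_iff.2 ⟨v', by assumption, hv⟩
    choose φ hφ using hφ
    have hinj : Function.Injective φ := by
      intro u v huv
      by_contra hne
      obtain ⟨i, hi, w, hwu, hwv, -, -, hew⟩ := h u v v v
      have hv : v ∈ e i := by
        rw [hφ v i hi, ← huv, ← hφ u i hi, hew]
        simp
      rw [hew] at hv
      simp only [Finset.mem_insert, Finset.mem_singleton] at hv
      grind
    refine ⟨Equiv.ofBijective φ (Finite.injective_iff_bijective.1 hinj), ?_⟩
    ext i v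
    simp [hW i v, hW' i _, hφ v i i.2]
  refine ⟨⟨W, hmix, rfl⟩, fun W₁ W₂ h1 g1 h2 g2 => ?_⟩
  obtain ⟨σ₁, e1⟩ := key W₁ h1 g1
  obtain ⟨σ₂, e2⟩ := key W₂ h2 g2
  refine ⟨σ₂.symm.trans σ₁, ?_⟩
  have : W₂ = W.submatrix id σ₂.symm := by rw [e2]; ext; simp
  rw [this, e1]
  ext; simp

/-! ### Correctness of the seed column and of the propagation step -/

/-- Let row `j` have entry `1` in row `0`, and let `k` have entry `1` in rows `0` and `j` if such an
index exists, and let `flag` be positive exactly if some further index has entry `1` in all three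
rows. If `flag` is positive, then `0`, `j`, `k` are three edges at a vertex, and the column of this
vertex consists of the edges that meet all three. If `flag = 0`, then `0`, `j`, `k` form a triangle,
and the column of the common endpoint of `0` and `j` consists of the edges that meet `0` and `j` and
are not parallel to `k`. -/
theorem seed_column {m n : ℕ} {e : ℕ → Finset (Fin n)} (he : IsEdgeList m e)
    (h : HasFourNeighbours m e) (hm : 0 < m) {j k flag : ℕ}
    (hj : (∃ f < m, (e 0 ∩ e f).card = 1) → (e 0 ∩ e j).card = 1)
    (hk : (∃ f < m, (e 0 ∩ e f).card = 1 ∧ (e j ∩ e f).card = 1) →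
      (e 0 ∩ e k).card = 1 ∧ (e j ∩ e k).card = 1)
    (hflag : 0 < flag ↔
      ∃ f < m, (e 0 ∩ e f).card = 1 ∧ (e j ∩ e f).card = 1 ∧ (e k ∩ e f).card = 1) :
    ∃ v, ∀ f < m, (v ∈ e f ↔ 0 < (e 0 ∩ e f).card * (e j ∩ e f).card *
      (flag * (e k ∩ e f).card + (1 - flag) * (2 - (e k ∩ e f).card))) := by
  have c := he.card_eq
  have h0 := c 0 hm
  have hj1 : (e 0 ∩ e j).card = 1 := by
    apply hj
    obtain ⟨u, v, huv, h0e⟩ := Finset.card_eq_two.1 h0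
    obtain ⟨i, hi, w, hwu, hwv, -, -, hew⟩ := h u v v v
    exact ⟨i, hi, by rw [h0e, hew]; exact card_inter_pair_pair hwv.symm⟩
  have hjm := (he.lt_of_inter hj1.ge).2
  obtain ⟨u, v, a, huv, hua, hva, h0e, hje⟩ := exists_pair_of_card_inter h0 (c j hjm) hj1
  obtain ⟨hk0, hkj⟩ : (e 0 ∩ e k).card = 1 ∧ (e j ∩ e k).card = 1 := by
    apply hk
    obtain ⟨i, hi, w, hwu, hwv, hwa, -, hew⟩ := h u v a a
    refine ⟨i, hi, ?_, ?_⟩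
    · rw [h0e, hew]; exact card_inter_pair_pair hwv.symm
    · rw [hje, hew]; exact card_inter_pair_pair hwa.symm
  have hkm := (he.lt_of_inter hk0.ge).2
  have hkc := c k hkm
  rcases Nat.eq_zero_or_pos flag with hf0 | hfpos
  · -- If `k` contained `u`, a fourth neighbour of `u` would make `flag` positive.
    have huk : u ∉ e k := by
      intro huk
      obtain ⟨b, hub, hke⟩ := exists_eq_pair hkc huk
      obtain ⟨i, hi, w, hwu, hwv, hwa, hwb, hew⟩ := h u v a b
      refine absurd (hflag.2 ⟨i, hi, ?_, ?_, ?_⟩) (by omega)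
      · rw [h0e, hew]; exact card_inter_pair_pair hwv.symm
      · rw [hje, hew]; exact card_inter_pair_pair hwa.symm
      · rw [hke, hew]; exact card_inter_pair_pair hwb.symm
    have hpair : ∀ F : Finset (Fin n), F.card = 2 → u ∉ F → 1 ≤ (e 0 ∩ F).card →
        1 ≤ (e j ∩ F).card → F = {v, a} := by
      intro F hF huF h1 h2
      rw [one_le_card_inter_iff, h0e] at h1
      rw [one_le_card_inter_iff, hje] at h2
      refine (Finset.eq_of_subset_of_card_le ?_ ?_).symm
      · grind
      · rw [hF, Finset.card_pair hva]
    have hke := hpair _ hkc huk hk0.ge hkj.ge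
    refine ⟨u, fun f hf => ?_⟩
    subst hf0
    simp only [zero_mul, zero_add, tsub_zero, one_mul]
    constructor
    · intro huf
      have h1 : 1 ≤ (e 0 ∩ e f).card := one_le_card_inter_iff.2 ⟨u, by simp [h0e], huf⟩
      have h2 : 1 ≤ (e j ∩ e f).card := one_le_card_inter_iff.2 ⟨u, by simp [hje], huf⟩
      have h3 : (e k ∩ e f).card < 2 := by
        by_contra hlt
        have : e k ∩ e f = e k :=
          Finset.eq_of_subset_of_card_le Finset.inter_subset_left (by omega)
        have : e k = e f := Finset.eq_of_subset_of_card_le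
          (Finset.inter_eq_left.1 this) (by rw [hkc, c f hf])
        exact huk (this ▸ huf)
      have : 0 < 2 - (e k ∩ e f).card := by omega
      positivity
    · intro hpos
      by_contra huf
      have h1 : 0 < (e 0 ∩ e f).card := by
        by_contra h0; simp [Nat.eq_zero_of_not_pos h0] at hpos
      have h2 : 0 < (e j ∩ e f).card := by
        by_contra h0; simp [Nat.eq_zero_of_not_pos h0] at hpos
      have := hpair _ (c f hf) huf h1 h2
      rw [this, ← hke] at hpos
      simp [hkc] at hpos
  · obtain ⟨l, hl, l0, lj, lk⟩ := hflag.1 hfpos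
    obtain ⟨x, x0, xj, xk, -⟩ := exists_common_of_four h0 (c j hjm) hkc (c l hl) hj1 hk0 l0 hkj lj lk
    refine ⟨x, fun f hf => ?_⟩
    have : 1 - flag = 0 := by omega
    simp only [this, zero_mul, add_zero]
    constructor
    · intro hx
      have h1 : 1 ≤ (e 0 ∩ e f).card := one_le_card_inter_iff.2 ⟨x, x0, hx⟩
      have h2 : 1 ≤ (e j ∩ e f).card := one_le_card_inter_iff.2 ⟨x, xj, hx⟩
      have h3 : 1 ≤ (e k ∩ e f).card := one_le_card_inter_iff.2 ⟨x, xk, hx⟩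
      positivity
    · intro hpos
      have h1 : 0 < (e 0 ∩ e f).card := by
        by_contra h0; simp [Nat.eq_zero_of_not_pos h0] at hpos
      have h2 : 0 < (e j ∩ e f).card := by
        by_contra h0; simp [Nat.eq_zero_of_not_pos h0] at hpos
      have h3 : 0 < (e k ∩ e f).card := by
        by_contra h0; simp [Nat.eq_zero_of_not_pos h0] at hpos
      exact mem_of_meets_three h0 (c j hjm) hkc (he.card_le f) x0 xj xk hj1 hk0 hkj h1 h2 h3

/-- The incidence of edge `f` and vertex `v`, as a number. -/
def inc {n : ℕ} (e : ℕ → Finset (Fin n)) (f : ℕ) (v : Fin n) : ℕ := if v ∈ e f then 1 else 0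

/-- The number of the vertices `v 0, …, v (k - 1)` on the edge `i`. -/
def knownCount {n : ℕ} (e : ℕ → Finset (Fin n)) (v : ℕ → Fin n) (k i : ℕ) : ℕ :=
  ∑ t ∈ Finset.range k, inc e i (v t)

/-- The sum of the indices `t < k` for which `v t` lies on the edge `i`. -/
def knownIndex {n : ℕ} (e : ℕ → Finset (Fin n)) (v : ℕ → Fin n) (k i : ℕ) : ℕ :=
  ∑ t ∈ Finset.range k, t * inc e i (v t)

/-- In a connected multigraph, as long as not all vertices are known, some edge has exactly one
known endpoint. -/
theorem exists_knownCount_eq_one {m n : ℕ} {e : ℕ → Finset (Fin n)} (hc : IsConn m e)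
    {v : ℕ → Fin n} {k : ℕ} (hv : Set.InjOn v (Set.Iio k)) (hk0 : 0 < k) (hkn : k < n) :
    ∃ i < m, knownCount e v k i = 1 := by
  classical
  set S := (Finset.range k).image v with hS
  have hScard : S.card = k := by
    rw [hS, Finset.card_image_of_injOn (by simpa [Finset.coe_range] using hv), Finset.card_range]
  obtain ⟨i, hi, u, hu, w, hw, hei⟩ := hc S (Finset.card_pos.1 (by omega)) (by
    intro h
    rw [h, Finset.card_univ, Fintype.card_fin] at hScard
    omega)
  obtain ⟨t, ht, rfl⟩ := Finset.mem_image.1 hu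
  refine ⟨i, hi, ?_⟩
  rw [knownCount, Finset.sum_eq_single_of_mem t ht]
  · simp [inc, hei]
  · intro s hs hst
    have h1 : v s ≠ v t := fun h =>
      hst (hv (by simpa using hs) (by simpa using ht) h)
    have h2 : v s ≠ w := by
      rintro rfl
      exact hw (Finset.mem_image_of_mem _ hs)
    simp [inc, hei, h1, h2]

/-- If the edge `i` has exactly one known endpoint, then subtracting the column of that endpoint
from the `i`-th row of the Gram matrix leaves the column of the other endpoint of `i`, which is a
new vertex. -/
theorem propagate {m n : ℕ} {e : ℕ → Finset (Fin n)} (he : IsEdgeList m e) {v : ℕ → Fin n}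
    {k i : ℕ} (hi : knownCount e v k i = 1) :
    knownIndex e v k i < k ∧ ∃ w, (∀ t < k, v t ≠ w) ∧
      ∀ f, (e i ∩ e f).card - inc e f (v (knownIndex e v k i)) = inc e f w := by
  have hex : ∃ t ∈ Finset.range k, inc e i (v t) ≠ 0 := by
    by_contra h
    push Not at h
    rw [knownCount, Finset.sum_eq_zero h] at hi
    omega
  obtain ⟨t, ht, hne⟩ := hex
  have hmem : v t ∈ e i := by
    by_contra h; simp [inc, h] at hne
  have hone : inc e i (v t) = 1 := by simp [inc, hmem]
  have hzero : ∀ s ∈ Finset.range k, s ≠ t → inc e i (v s) = 0 := by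
    intro s hs hst
    have := Finset.add_sum_erase _ (fun t => inc e i (v t)) ht
    rw [knownCount] at hi
    have h0 : ∑ x ∈ (Finset.range k).erase t, inc e i (v x) = 0 := by
      simp only [hone] at this
      omega
    exact Finset.sum_eq_zero_iff.1 h0 s (Finset.mem_erase.2 ⟨hst, hs⟩)
  have hidx : knownIndex e v k i = t := by
    rw [knownIndex, Finset.sum_eq_single_of_mem t ht, hone, mul_one]
    intro s hs hst
    rw [hzero s hs hst, mul_zero]
  obtain ⟨w, hw, hei⟩ := exists_eq_pair (he.card_eq i (he.lt_of_mem hmem)) hmem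
  refine ⟨by rw [hidx]; simpa using ht, w, fun s hs hsw => ?_, fun f => ?_⟩
  · by_cases hst : s = t
    · exact hw (hst ▸ hsw)
    · have := hzero s (by simpa using hs) hst
      simp [inc, hei, hsw] at this
  · rw [hidx, hei]
    unfold inc
    by_cases h1 : v t ∈ e f <;> by_cases h2 : w ∈ e f <;>
      simp [h1, h2, Finset.insert_inter_of_mem, Finset.insert_inter_of_notMem,
        Finset.singleton_inter_of_mem, Finset.singleton_inter_of_notMem, Finset.card_pair hw]

/-! ### Random selection vectors -/

section Probability

open MeasureTheory

/-- The indicator vector of a set of vertices. -/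
def indVec {n : ℕ} (T : Finset (Fin n)) : Fin n → ℕ := fun j => if j ∈ T then 1 else 0

theorem indVec_injective {n : ℕ} : Function.Injective (indVec (n := n)) := by
  intro S T h
  ext j
  have := congrFun h j
  simp only [indVec] at this
  split_ifs at this <;> simp_all

/-- The indicator vectors of the edges between `X` and `Y`. -/
def Cross {n : ℕ} (X Y : Finset (Fin n)) : Set (Fin n → ℕ) :=
  {w | ∃ x ∈ X, ∃ y ∈ Y, w = indVec {x, y}}

theorem privSupport_eq (n : ℕ) :
    privSupport n = ↑((Finset.univ.powersetCard 2).image (indVec (n := n))) := by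
  ext w
  simp only [privSupport, Set.mem_ofPred_eq, Finset.coe_image, Set.mem_image, Finset.mem_coe,
    Finset.mem_powersetCard, Finset.subset_univ, true_and]
  constructor
  · rintro ⟨T, hT, rfl⟩
    exact ⟨T, hT, rfl⟩
  · rintro ⟨T, hT, rfl⟩
    exact ⟨T, hT, rfl⟩

theorem card_image_indVec (n : ℕ) :
    ((Finset.univ.powersetCard 2).image (indVec (n := n))).card = n.choose 2 := by
  rw [Finset.card_image_of_injective _ indVec_injective, Finset.card_powersetCard,
    Finset.card_univ, Fintype.card_fin]

theorem privSupport_finite (n : ℕ) : (privSupport n).Finite := by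
  rw [privSupport_eq]
  exact Finset.finite_toSet _

theorem privSupport_nonempty {n : ℕ} (hn : 2 ≤ n) : (privSupport n).Nonempty := by
  rw [privSupport_eq, Finset.coe_nonempty, ← Finset.card_pos, card_image_indVec]
  exact Nat.choose_pos hn

theorem isProbabilityMeasure_privDist {n : ℕ} (hn : 2 ≤ n) : IsProbabilityMeasure (privDist n) :=
  ProbabilityTheory.isProbabilityMeasure_uniformOn (privSupport_finite n) (privSupport_nonempty hn)

/-- A private selection vector misses the edges between `X` and `Y` with probability
`1 - |X| |Y| / (n choose 2)`. -/
theorem privDist_compl_cross_le {n : ℕ} (hn : 2 ≤ n) {X Y : Finset (Fin n)} (hXY : Disjoint X Y) :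
    (privDist n).real (Cross X Y)ᶜ ≤ Real.exp (-(2 * (X.card * Y.card) / (n : ℝ) ^ 2)) := by
  classical
  set S := (Finset.univ.powersetCard 2).image (indVec (n := n)) with hS
  set A := (X ×ˢ Y).image (fun p => indVec ({p.1, p.2} : Finset (Fin n))) with hA
  have hcross : Cross X Y = (A : Set (Fin n → ℕ)) := by
    ext w
    simp only [Cross, Set.mem_ofPred_eq, hA, Finset.coe_image, Set.mem_image, Finset.mem_coe,
      Finset.mem_product, Prod.exists]
    constructor
    · rintro ⟨x, hx, y, hy, rfl⟩
      exact ⟨x, y, ⟨hx, hy⟩, rfl⟩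
    · rintro ⟨x, y, ⟨hx, hy⟩, rfl⟩
      exact ⟨x, hx, y, hy, rfl⟩
  have hAS : A ⊆ S := by
    intro w hw
    obtain ⟨p, hp, rfl⟩ := Finset.mem_image.1 hw
    obtain ⟨h1, h2⟩ := Finset.mem_product.1 hp
    refine Finset.mem_image_of_mem _ (Finset.mem_powersetCard.2 ⟨Finset.subset_univ _, ?_⟩)
    exact Finset.card_pair (fun h => Finset.disjoint_left.1 hXY h1 (h ▸ h2))
  have hAcard : A.card = X.card * Y.card := by
    rw [hA, Finset.card_image_of_injOn, Finset.card_product]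
    rintro ⟨x, y⟩ hp ⟨x', y'⟩ hp' h
    have h := indVec_injective h
    simp only [Finset.coe_product, Set.mem_prod, Finset.mem_coe] at hp hp'
    have hx : x ∈ ({x', y'} : Finset (Fin n)) := by
      have : x ∈ ({x, y} : Finset (Fin n)) := by simp
      exact h ▸ this
    have hy : y ∈ ({x', y'} : Finset (Fin n)) := by
      have : y ∈ ({x, y} : Finset (Fin n)) := by simp
      exact h ▸ this
    have : ∀ z ∈ X, z ∉ Y := fun z hz => Finset.disjoint_left.1 hXY hz
    simp only [Finset.mem_insert, Finset.mem_singleton] at hx hy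
    grind
  have hScard : S.card = n.choose 2 := card_image_indVec n
  have hSpos : (0 : ℝ) < n.choose 2 := by exact_mod_cast Nat.choose_pos hn
  have h1 : (privDist n).real (Cross X Y)ᶜ =
      1 - (X.card * Y.card : ℝ) / n.choose 2 := by
    have e : privDist n (Cross X Y)ᶜ = ((S.card - A.card : ℕ) : ENNReal) / S.card := by
      rw [privDist, ← ProbabilityTheory.uniformOn_inter_self (privSupport_finite n), hcross,
        privSupport_eq, ← hS, ← Set.sdiff_eq, ← Finset.coe_sdiff,
        ProbabilityTheory.uniformOn_apply_finset,
        Finset.inter_eq_right.2 Finset.sdiff_subset, Finset.card_sdiff_of_subset hAS]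
    have hle : A.card ≤ S.card := Finset.card_le_card hAS
    rw [measureReal_def, e, ENNReal.toReal_div, ENNReal.toReal_natCast, ENNReal.toReal_natCast,
      Nat.cast_sub hle, hAcard, hScard, sub_div, div_self hSpos.ne']
    push_cast
    ring
  have hchoose : (n.choose 2 : ℝ) ≤ (n : ℝ) ^ 2 / 2 := by
    rw [Nat.cast_choose_two]
    have : (0 : ℝ) ≤ n := by positivity
    nlinarith
  have h2 : 2 * (X.card * Y.card) / (n : ℝ) ^ 2 ≤ (X.card * Y.card : ℝ) / n.choose 2 := by
    have h0 : (0 : ℝ) ≤ X.card * Y.card := by positivity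
    calc 2 * (X.card * Y.card) / (n : ℝ) ^ 2 = (X.card * Y.card) / ((n : ℝ) ^ 2 / 2) := by
          field_simp
      _ ≤ _ := by gcongr
  rw [h1]
  calc 1 - (X.card * Y.card : ℝ) / n.choose 2 ≤ Real.exp (-((X.card * Y.card : ℝ) / n.choose 2)) :=
        Real.one_sub_le_exp_neg _
    _ ≤ _ := Real.exp_le_exp.2 (neg_le_neg h2)

theorem isProbabilityMeasure_sampleLaw (m : ℕ) {n : ℕ} (hn : 2 ≤ n) :
    IsProbabilityMeasure (sampleLaw m n) := by
  have := isProbabilityMeasure_privDist hn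
  unfold sampleLaw
  infer_instance

theorem sampleLaw_forall {m n : ℕ} (hn : 2 ≤ n) (A : Set (Fin n → ℕ)) :
    (sampleLaw m n).real {w | ∀ i, w i ∈ A} = (privDist n).real A ^ m := by
  have := isProbabilityMeasure_privDist hn
  have h : {w : Fin m → Fin n → ℕ | ∀ i, w i ∈ A} = Set.univ.pi fun _ => A := by
    ext w; simp
  rw [h, sampleLaw, measureReal_def, Measure.pi_pi]
  simp [measureReal_def]

theorem sampleLaw_miss_le {m n : ℕ} (hn : 2 ≤ n) {X Y : Finset (Fin n)} (hXY : Disjoint X Y) :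
    (sampleLaw m n).real {w | ∀ i, w i ∉ Cross X Y} ≤
      Real.exp (-(m * (2 * (X.card * Y.card) / (n : ℝ) ^ 2))) := by
  have h := sampleLaw_forall (m := m) hn (Cross X Y)ᶜ
  simp only [Set.mem_compl_iff] at h
  rw [h]
  calc (privDist n).real (Cross X Y)ᶜ ^ m
      ≤ Real.exp (-(2 * (X.card * Y.card) / (n : ℝ) ^ 2)) ^ m :=
        pow_le_pow_left₀ measureReal_nonneg (privDist_compl_cross_le hn hXY) m
    _ = _ := by rw [← Real.exp_nat_mul]; congr 1; ring

theorem sampleLaw_not_mixup {m n : ℕ} (hn : 2 ≤ n) :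
    (sampleLaw m n).real {w | ¬ IsMixup (Matrix.of w)} = 0 := by
  have := isProbabilityMeasure_privDist hn
  have := isProbabilityMeasure_sampleLaw m hn
  have h1 : (sampleLaw m n).real {w | ∀ i, w i ∈ privSupport n} = 1 := by
    rw [sampleLaw_forall hn, measureReal_def, privDist,
      ProbabilityTheory.uniformOn_self (privSupport_finite n) (privSupport_nonempty hn)]
    simp
  have hmeas : MeasurableSet {w : Fin m → Fin n → ℕ | ∀ i, w i ∈ privSupport n} :=
    (Set.to_countable _).measurableSet
  have h2 := probReal_compl_eq_one_sub (μ := sampleLaw m n) hmeas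
  rw [h1, sub_self] at h2
  exact h2

/-- The sample is good if it hits the edges from `v` to the complement of every four-element set
`{v, a, b, c}`, and the edges leaving every nonempty set of at most half of the vertices. -/
structure IsGood {m n : ℕ} (w : Fin m → Fin n → ℕ) : Prop where
  mixup : IsMixup (Matrix.of w)
  star : ∀ v a b c : Fin n, ∃ i, w i ∈ Cross {v} ({v, a, b, c} : Finset (Fin n))ᶜ
  cut : ∀ S : Finset (Fin n), S.Nonempty → 2 * S.card ≤ n → ∃ i, w i ∈ Cross S Sᶜ

theorem IsIncidence.eq_pair {m n : ℕ} {w : Fin m → Fin n → ℕ} {e : ℕ → Finset (Fin n)}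
    (h : IsIncidence (Matrix.of w) e) {i : Fin m} {x y : Fin n} (hw : w i = indVec {x, y}) :
    e i = {x, y} :=
  indVec_injective (by rw [← hw]; funext j; exact (h i j).symm)

theorem IsGood.hasFourNeighbours {m n : ℕ} {w : Fin m → Fin n → ℕ} (h : IsGood w)
    {e : ℕ → Finset (Fin n)} (he : IsIncidence (Matrix.of w) e) : HasFourNeighbours m e := by
  intro v a b c
  obtain ⟨i, x, hx, y, hy, hw⟩ := h.star v a b c
  obtain rfl := Finset.mem_singleton.1 hx
  simp only [Finset.mem_compl, Finset.mem_insert, Finset.mem_singleton, not_or] at hy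
  exact ⟨i, i.2, y, hy.1, hy.2.1, hy.2.2.1, hy.2.2.2, he.eq_pair hw⟩

theorem IsGood.isConn {m n : ℕ} {w : Fin m → Fin n → ℕ} (h : IsGood w)
    {e : ℕ → Finset (Fin n)} (he : IsIncidence (Matrix.of w) e) : IsConn m e := by
  intro S hne huniv
  by_cases hS : 2 * S.card ≤ n
  · obtain ⟨i, x, hx, y, hy, hw⟩ := h.cut S hne hS
    exact ⟨i, i.2, x, hx, y, Finset.mem_compl.1 hy, he.eq_pair hw⟩
  · have hcard := Finset.card_compl S
    rw [Fintype.card_fin] at hcard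
    obtain ⟨i, x, hx, y, hy, hw⟩ := h.cut Sᶜ
      (by rwa [Finset.nonempty_iff_ne_empty, Ne, Finset.compl_eq_empty_iff]) (by omega)
    rw [compl_compl] at hy
    exact ⟨i, i.2, y, hy, x, Finset.mem_compl.1 hx, by rw [he.eq_pair hw, Finset.pair_comm]⟩

theorem sum_nonempty_pow_card_le {n : ℕ} {q : ℝ} (hq : 0 ≤ q) (hnq : n * q ≤ 1) :
    ∑ S : Finset (Fin n) with S.Nonempty, q ^ S.card ≤ 2 * (n * q) := by
  have h1 : ∑ S : Finset (Fin n), q ^ S.card = (q + 1) ^ n := by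
    simpa using Fin.sum_pow_mul_eq_add_pow (n := n) q 1
  have h2 : ∑ S : Finset (Fin n), q ^ S.card =
      1 + ∑ S : Finset (Fin n) with S.Nonempty, q ^ S.card := by
    rw [← Finset.sum_filter_add_sum_filter_not Finset.univ (fun S : Finset (Fin n) => ¬ S.Nonempty)]
    congr 1
    · have : (Finset.univ.filter fun S : Finset (Fin n) => ¬ S.Nonempty) = {∅} := by
        ext S; simp [Finset.not_nonempty_iff_eq_empty]
      rw [this]; simp
    · simp [Finset.nonempty_iff_ne_empty]
  have h3 : (q + 1) ^ n ≤ Real.exp (n * q) := by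
    rw [Real.exp_nat_mul]
    exact pow_le_pow_left₀ (by positivity) (Real.add_one_le_exp q) n
  have hnq0 : 0 ≤ n * q := by positivity
  have h4 := Real.abs_exp_sub_one_le (x := n * q) (by rwa [abs_of_nonneg hnq0])
  rw [abs_of_nonneg hnq0] at h4
  have := le_abs_self (Real.exp (n * q) - 1)
  linarith

/-- The union bound: a sample of size `m ≥ (5 / 2) (c + 6) n log n` is good with probability at
least `1 - n ^ (-c)`. With `q = n ^ (-c - 6)`, each of the `n ^ 4` conditions at a vertex fails with
probability at most `q`, and the condition for a set of `s` vertices fails with probability at most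
`q ^ s`. -/
theorem sampleLaw_not_isGood_le {m n : ℕ} {c : ℝ} (hc : 0 < c) (hn : 5 ≤ n)
    (hm : 5 / 2 * (c + 6) * (n * Real.log n) ≤ m) :
    (sampleLaw m n).real {w | ¬ IsGood w} ≤ (n : ℝ) ^ (-c) := by
  classical
  have hn2 : 2 ≤ n := by omega
  have := isProbabilityMeasure_sampleLaw m hn2
  have hnR : (5 : ℝ) ≤ n := by exact_mod_cast hn
  have hn0 : (0 : ℝ) < n := by linarith
  have hlog : 0 < Real.log n := Real.log_pos (by linarith)
  set r : ℝ := (n : ℝ) ^ (-c) with hr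
  have hr0 : 0 < r := Real.rpow_pos_of_pos hn0 _
  have hr1 : r ≤ 1 := Real.rpow_le_one_of_one_le_of_nonpos (by linarith) (by linarith)
  set q : ℝ := r / (n : ℝ) ^ 6 with hqdef
  have hq0 : 0 < q := by positivity
  have hqexp : Real.exp (-((c + 6) * Real.log n)) = q := by
    have h6 : (n : ℝ) ^ 6 = Real.exp (6 * Real.log n) := by
      have := Real.exp_nat_mul (Real.log n) 6
      rw [Real.exp_log hn0] at this
      rw [← this]
      norm_num
    rw [hqdef, hr, Real.rpow_def_of_pos hn0, h6, ← Real.exp_sub]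
    congr 1
    ring
  -- `m / n` in terms of the logarithm
  have hmn : 5 / 2 * (c + 6) * Real.log n ≤ m / n := by
    rw [le_div_iff₀ hn0]
    linarith
  have hstar : ∀ p : Fin n × Fin n × Fin n × Fin n,
      (sampleLaw m n).real {w | ∀ i, w i ∉ Cross {p.1}
        ({p.1, p.2.1, p.2.2.1, p.2.2.2} : Finset (Fin n))ᶜ} ≤ q := by
    rintro ⟨v, a, b, d⟩
    refine (sampleLaw_miss_le hn2 (by simp)).trans ?_
    rw [← hqexp]
    apply Real.exp_le_exp.2
    have h4 : ({v, a, b, d} : Finset (Fin n)).card ≤ 4 := Finset.card_le_four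
    have hcard := Finset.card_compl ({v, a, b, d} : Finset (Fin n))
    rw [Fintype.card_fin] at hcard
    have h5 : n ≤ 5 * ({v, a, b, d} : Finset (Fin n))ᶜ.card := by omega
    have h5R : (n : ℝ) ≤ 5 * (({v, a, b, d} : Finset (Fin n))ᶜ.card : ℝ) := by exact_mod_cast h5
    simp only [Finset.card_singleton, Nat.cast_one, one_mul, neg_le_neg_iff]
    calc (c + 6) * Real.log n = 2 / 5 * (5 / 2 * (c + 6) * Real.log n) := by ring
      _ ≤ 2 / 5 * (m / n) := by gcongr
      _ = m * (2 * (n / 5) / (n : ℝ) ^ 2) := by field_simp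
      _ ≤ _ := by gcongr; linarith
  have hcut : ∀ S ∈ Finset.univ.filter (fun S : Finset (Fin n) => S.Nonempty ∧ 2 * S.card ≤ n),
      (sampleLaw m n).real {w | ∀ i, w i ∉ Cross S Sᶜ} ≤ q ^ S.card := by
    intro S hS
    obtain ⟨-, -, hS⟩ := Finset.mem_filter.1 hS
    refine (sampleLaw_miss_le hn2 disjoint_compl_right).trans ?_
    rw [← hqexp, ← Real.exp_nat_mul]
    apply Real.exp_le_exp.2
    have hcard := Finset.card_compl S
    rw [Fintype.card_fin] at hcard
    have h5 : n ≤ 2 * Sᶜ.card := by omega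
    have h5R : (n : ℝ) ≤ 2 * (Sᶜ.card : ℝ) := by exact_mod_cast h5
    rw [mul_neg, neg_le_neg_iff]
    calc (S.card : ℝ) * ((c + 6) * Real.log n) ≤ S.card * (5 / 2 * (c + 6) * Real.log n) := by
          gcongr; nlinarith
      _ ≤ S.card * (m / n) := by gcongr
      _ = m * (2 * (S.card * (n / 2)) / (n : ℝ) ^ 2) := by field_simp
      _ ≤ _ := by gcongr; linarith
  have hsub : {w : Fin m → Fin n → ℕ | ¬ IsGood w} ⊆ {w | ¬ IsMixup (Matrix.of w)} ∪
      ((⋃ p ∈ (Finset.univ : Finset (Fin n × Fin n × Fin n × Fin n)), {w | ∀ i, w i ∉ Cross {p.1}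
        ({p.1, p.2.1, p.2.2.1, p.2.2.2} : Finset (Fin n))ᶜ}) ∪
      ⋃ S ∈ Finset.univ.filter (fun S : Finset (Fin n) => S.Nonempty ∧ 2 * S.card ≤ n),
        {w | ∀ i, w i ∉ Cross S Sᶜ}) := by
    intro w hw
    by_contra hcon
    simp only [Set.mem_union, Set.mem_iUnion, Set.mem_ofPred_eq, not_or, not_exists, not_and,
      not_forall, not_not, Finset.mem_univ, Finset.mem_filter, true_and, exists_prop] at hcon
    obtain ⟨h1, h2, h3⟩ := hcon
    exact hw ⟨h1, fun v a b d => h2 (v, a, b, d), fun S hS hS' => h3 S ⟨hS, hS'⟩⟩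
  have hn6 : (0 : ℝ) < (n : ℝ) ^ 6 := by positivity
  have hnq : n * q ≤ 1 := by
    rw [hqdef, mul_div_assoc', div_le_one hn6]
    calc (n : ℝ) * r ≤ n * 1 := by gcongr
      _ = (n : ℝ) ^ 1 := by ring
      _ ≤ (n : ℝ) ^ 6 := pow_le_pow_right₀ (by linarith) (by norm_num)
  have hA : (sampleLaw m n).real (⋃ p ∈ (Finset.univ : Finset (Fin n × Fin n × Fin n × Fin n)),
      {w | ∀ i, w i ∉ Cross {p.1} ({p.1, p.2.1, p.2.2.1, p.2.2.2} : Finset (Fin n))ᶜ}) ≤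
      (n : ℝ) ^ 4 * q := by
    refine (measureReal_biUnion_finset_le _ _).trans
      ((Finset.sum_le_sum fun p _ => hstar p).trans ?_)
    rw [Finset.sum_const, nsmul_eq_mul, Finset.card_univ]
    simp only [Fintype.card_prod, Fintype.card_fin, Nat.cast_mul]
    exact le_of_eq (by ring)
  have hB : (sampleLaw m n).real (⋃ S ∈ Finset.univ.filter
      (fun S : Finset (Fin n) => S.Nonempty ∧ 2 * S.card ≤ n), {w | ∀ i, w i ∉ Cross S Sᶜ}) ≤
      2 * (n * q) := by
    refine (measureReal_biUnion_finset_le _ _).trans ((Finset.sum_le_sum hcut).trans ?_)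
    refine le_trans (Finset.sum_le_sum_of_subset_of_nonneg ?_ fun _ _ _ => by positivity)
      (sum_nonempty_pow_card_le hq0.le hnq)
    intro S hS
    simp only [Finset.mem_filter] at hS ⊢
    exact ⟨hS.1, hS.2.1⟩
  have hfin : (n : ℝ) ^ 4 * q + 2 * (n * q) ≤ r := by
    have h4 : (n : ℝ) ^ 4 * 3 ≤ (n : ℝ) ^ 6 := by
      have : (0 : ℝ) < (n : ℝ) ^ 4 := by positivity
      have h2 : (3 : ℝ) ≤ (n : ℝ) ^ 2 := by nlinarith
      calc (n : ℝ) ^ 4 * 3 ≤ (n : ℝ) ^ 4 * (n : ℝ) ^ 2 := by gcongr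
        _ = _ := by ring
    have h1 : (n : ℝ) ≤ (n : ℝ) ^ 4 := le_self_pow₀ (by linarith) (by norm_num)
    have hqn : r = q * (n : ℝ) ^ 6 := by rw [hqdef]; field_simp
    rw [hqn]
    nlinarith
  calc (sampleLaw m n).real {w | ¬ IsGood w} ≤ _ := measureReal_mono hsub
    _ ≤ _ := measureReal_union_le _ _
    _ ≤ 0 + ((n : ℝ) ^ 4 * q + 2 * (n * q)) := by
        refine add_le_add (sampleLaw_not_mixup hn2).le ((measureReal_union_le _ _).trans ?_)
        exact add_le_add hA hB
    _ ≤ r := by linarith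

end Probability

/-! ### The program -/

/-- Sets up the memory. Cell `0` receives the address `32 + 2 * m` of the output, cells `1`, `2`
hold `n`, `m`, cells `5`, `6`, `7` hold the constants `1`, `0`, `2`, and cells `8`, `9` the addresses
`32`, `32 + m` of two arrays of length `m`: for each edge, the number of its known endpoints, and the
sum of the numbers of their columns. Later, cell `3` is the counter of the inner loops, cell `4` the
number of columns written so far, and cells `20`, …, `24` hold intermediate results. -/
def codeInit : Program :=
  [.add 2 0 6, .const 5 1, .const 7 2, .const 8 32, .add 9 8 2, .add 0 9 2]

/-- `mem[10]` becomes the last index with entry `1` in row `0`. -/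
def codeFindJ : Program :=
  [.query 20 6 3, .sub 21 7 20, .mul 21 20 21, .sub 22 3 10, .mul 22 21 22, .add 10 10 22,
    .add 3 3 5]

/-- `mem[11]` becomes the last index with entry `1` in rows `0` and `mem[10]`. -/
def codeFindK : Program :=
  [.query 20 6 3, .query 21 10 3, .sub 22 7 20, .mul 22 20 22, .sub 23 7 21, .mul 23 21 23,
    .mul 22 22 23, .sub 23 3 11, .mul 23 22 23, .add 11 11 23, .add 3 3 5]

/-- `mem[12]` counts the indices with entry `1` in rows `0`, `mem[10]` and `mem[11]`. -/
def codeCount : Program :=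
  [.query 20 6 3, .query 21 10 3, .sub 22 7 20, .mul 22 20 22, .sub 23 7 21, .mul 23 21 23,
    .mul 22 22 23, .query 21 11 3, .sub 23 7 21, .mul 23 21 23, .mul 22 22 23, .add 12 12 22,
    .add 3 3 5]

/-- Computes one entry of the seed column, and writes it to the first array and to the output. -/
def codeSeed : Program :=
  [.query 20 6 3, .query 21 10 3, .mul 20 20 21, .query 21 11 3, .mul 22 12 21, .sub 23 5 12,
    .sub 24 7 21, .mul 23 23 24, .add 22 22 23, .mul 20 20 22, .sub 20 5 20, .sub 20 5 20,
    .add 21 8 3, .store 21 20, .mul 21 3 1, .add 21 21 0, .store 21 20, .add 3 3 5]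

/-- `mem[13]` becomes the last edge with exactly one known endpoint. -/
def codeFindEdge : Program :=
  [.add 20 8 3, .load 20 20, .sub 21 7 20, .mul 21 20 21, .sub 22 3 13, .mul 22 21 22,
    .add 13 13 22, .add 3 3 5]

/-- Computes one entry of the column with number `mem[4]` in cell `23`, as the difference of an
entry of row `mem[13]` of the input and an entry of column `mem[14]` of the output. -/
def codeDiff : Program :=
  [.mul 20 3 1, .add 20 20 0, .add 21 20 14, .load 22 21, .query 23 13 3, .sub 23 23 22]

/-- Writes cell `23` to the output column `mem[4]`, and updates the two arrays. -/
def codeUpdate : Program :=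
  [.add 20 20 4, .store 20 23, .add 20 8 3, .load 21 20, .add 21 21 23, .store 20 21,
    .add 20 9 3, .load 21 20, .mul 22 4 23, .add 21 21 22, .store 20 21, .add 3 3 5]

/-- The program. All tests are arithmetic: for entries `x ≤ 2`, the number `x * (2 - x)` is `1` if
`x = 1` and `0` otherwise. Cell `3` starts
at `0` and is reset before every later inner loop. The main loop, which writes one further column per
round, starts at instruction `63`. -/
def program : Program :=
  codeInit ++ codeFindJ ++ [.jumpLt 3 2 6] ++ [.const 3 0] ++ codeFindK ++ [.jumpLt 3 2 15] ++
    [.const 3 0] ++ codeCount ++ [.jumpLt 3 2 28] ++ [.const 3 0] ++ codeSeed ++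
    [.jumpLt 3 2 43] ++ [.const 4 1] ++ [.const 3 0, .const 13 0] ++ codeFindEdge ++
    [.jumpLt 3 2 65] ++ [.add 20 9 13, .load 14 20, .const 3 0] ++ (codeDiff ++ codeUpdate) ++
    [.jumpLt 3 2 77] ++ [.add 4 4 5] ++ [.jumpLt 4 1 63]

/-- The cells that hold the constants of the computation. -/
structure Base (m n : ℕ) (s : ℕ → ℕ) : Prop where
  out : s 0 = 32 + 2 * m
  cols : s 1 = n
  rows : s 2 = m
  one : s 5 = 1
  zero : s 6 = 0
  two : s 7 = 2
  arr : s 8 = 32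
  arr' : s 9 = 32 + m

/-- `j ≤ t`, and `p j = 1` if `p` takes the value `1` below `t`. -/
def Found (p : ℕ → ℕ) (t j : ℕ) : Prop := j ≤ t ∧ ((∃ f < t, p f = 1) → p j = 1)

theorem Found.zero (p : ℕ → ℕ) : Found p 0 0 := ⟨le_rfl, fun ⟨_, h, _⟩ => by omega⟩

theorem Found.succ {p : ℕ → ℕ} {t j : ℕ} (h : Found p t j) (hp : p t ≤ 1) :
    Found p (t + 1) (j + p t * (t - j)) := by
  obtain ⟨h1, h2⟩ := h
  rcases Nat.le_one_iff_eq_zero_or_eq_one.1 hp with h0 | h0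
  · refine ⟨by simp only [h0]; omega, fun ⟨f, hf, hpf⟩ => ?_⟩
    have : f ≠ t := by rintro rfl; omega
    simpa [h0] using h2 ⟨f, by omega, hpf⟩
  · have : j + p t * (t - j) = t := by rw [h0]; omega
    rw [this]
    exact ⟨by omega, fun _ => h0⟩

theorem mul_two_sub_le {x : ℕ} : x * (2 - x) ≤ 1 := by
  rcases x with _ | _ | x <;> simp

theorem mul_two_sub_eq_one_iff {x : ℕ} : x * (2 - x) = 1 ↔ x = 1 := by
  rcases x with _ | _ | x <;> simp

/-- The numerical facts that bound every number stored by the program by `B`. -/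
structure Large (m n B : ℕ) : Prop where
  rows_pos : 1 ≤ m
  cols_ge : 2 ≤ n
  bound : 100 * (m * n) ^ 2 ≤ B

theorem Large.linear {m n B : ℕ} (h : Large m n B) :
    100 ≤ B ∧ 100 * m ≤ B ∧ 100 * n ≤ B ∧ 100 * (m * n) ≤ B ∧ 100 * (n * n) ≤ B := by
  obtain ⟨h1, h2, h3⟩ := h
  have a : 1 ≤ m * n := Nat.mul_pos h1 (by omega)
  have b : m * n ≤ (m * n) ^ 2 := Nat.le_self_pow (by norm_num) _
  have c : m ≤ m * n := Nat.le_mul_of_pos_right _ (by omega)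
  have d : n ≤ m * n := Nat.le_mul_of_pos_left _ (by omega)
  have e : n * n ≤ (m * n) ^ 2 := by rw [sq]; exact Nat.mul_le_mul d d
  refine ⟨?_, ?_, ?_, ?_, ?_⟩ <;> omega

/-! ### Verification of the program -/

section Scans

variable {m n B : ℕ} {M : Matrix (Fin m) (Fin m) ℕ}

/-- The state during the search for the seed: registers `10`, `11`, `12` hold `j`, `k`, `flag`,
register `3` holds `t`, and the arrays are still zero. -/
structure SeedState (m n t j k flag : ℕ) (s : ℕ → ℕ) : Prop extends Base m n s where
  idx : s 3 = t
  reg_j : s 10 = j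
  reg_k : s 11 = k
  reg_flag : s 12 = flag
  arrays : ∀ a, 32 ≤ a → s a = 0

theorem runs_findJ (hL : Large m n B) (hM : ∀ i j, entry M i j ≤ 2) {s : ℕ → ℕ}
    (hs : ∀ a, s a ≤ B) (h : SeedState m n 0 0 0 0 s) :
    ∃ s' j, Runs program M B (m * 8) 6 s 14 s' ∧ SeedState m n m j 0 0 s' ∧
      Found (fun f => entry M 0 f * (2 - entry M 0 f)) m j := by
  obtain ⟨l1, l2, l3, l4, l5⟩ := hL.linear
  refine Exists.elim (runs_loop (P := program) (M := M) (B := B) (T := 7) (pc := 6)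
    (q := 13) (a := 3) (b := 2) (N := m)
    (I := fun t s => ∃ j, SeedState m n t j 0 0 s ∧
      Found (fun f => entry M 0 f * (2 - entry M 0 f)) t j) hL.rows_pos rfl ?_ hs
    ⟨0, h, Found.zero _⟩) ?_
  swap
  · rintro s' ⟨hr, j, h1, h2⟩
    exact ⟨s', j, hr, h1, h2⟩
  rintro t ht s hs ⟨j, ⟨⟨b0, b1, b2, b5, b6, b7, b8, b9⟩, h3, h10, h11, h12, hz⟩, hf⟩
  have hp : entry M 0 t * (2 - entry M 0 t) ≤ 1 := mul_two_sub_le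
  have hx := hM 0 t
  have hf' := hf.succ hp
  have hjle := hf'.1
  obtain ⟨s', hr, hq⟩ := runs_block codeFindJ (Q := fun s' =>
      SeedState m n (t + 1) (j + entry M 0 t * (2 - entry M 0 t) * (t - j)) 0 0 s')
    (P := program) (M := M) (B := B) (pc := 6) ⟨_, rfl⟩ hs (by
      simp [codeFindJ, wp, IsStraight, value, target, write, h3, h10, b6, b7, b5]
      repeat refine ⟨by omega, ?_⟩
      refine ⟨⟨?_, ?_, ?_, ?_, ?_, ?_, ?_, ?_⟩, ?_, ?_, ?_, ?_, ?_⟩ <;> simp [write, *]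
      intro a ha
      simp [show a ≠ 3 by omega, show a ≠ 10 by omega, show a ≠ 20 by omega, show a ≠ 21 by omega,
        show a ≠ 22 by omega, hz a ha])
  exact ⟨s', hr, ⟨_, hq, hf'⟩, by rw [hq.idx, hq.rows]⟩


theorem runs_findK (hL : Large m n B) (hM : ∀ i j, entry M i j ≤ 2) {s : ℕ → ℕ} {j : ℕ}
    (hs : ∀ a, s a ≤ B) (h : SeedState m n 0 j 0 0 s) :
    ∃ s' k, Runs program M B (m * 12) 15 s 27 s' ∧ SeedState m n m j k 0 s' ∧
      Found (fun f => entry M 0 f * (2 - entry M 0 f) * (entry M j f * (2 - entry M j f))) m k := by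
  obtain ⟨l1, l2, l3, l4, l5⟩ := hL.linear
  refine Exists.elim (runs_loop (P := program) (M := M) (B := B) (T := 11) (pc := 15)
    (q := 26) (a := 3) (b := 2) (N := m)
    (I := fun t s => ∃ k, SeedState m n t j k 0 s ∧
      Found (fun f => entry M 0 f * (2 - entry M 0 f) * (entry M j f * (2 - entry M j f))) t k)
    hL.rows_pos rfl ?_ hs ⟨0, h, Found.zero _⟩) ?_
  swap
  · rintro s' ⟨hr, k, h1, h2⟩
    exact ⟨s', k, hr, h1, h2⟩
  rintro t ht s hs ⟨k, ⟨⟨b0, b1, b2, b5, b6, b7, b8, b9⟩, h3, h10, h11, h12, hz⟩, hf⟩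
  have hp1 : entry M 0 t * (2 - entry M 0 t) ≤ 1 := mul_two_sub_le
  have hp2 : entry M j t * (2 - entry M j t) ≤ 1 := mul_two_sub_le
  have hp := Nat.mul_le_mul hp1 hp2
  have hx := hM 0 t
  have hy := hM j t
  have hf' := hf.succ hp
  have hjle := hf'.1
  obtain ⟨s', hr, hq⟩ := runs_block codeFindK (Q := fun s' =>
      SeedState m n (t + 1) j (k + entry M 0 t * (2 - entry M 0 t) *
        (entry M j t * (2 - entry M j t)) * (t - k)) 0 s')
    (P := program) (M := M) (B := B) (pc := 15) ⟨_, rfl⟩ hs (by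
      simp [codeFindK, wp, IsStraight, value, target, write, h3, h10, h11, b6, b7, b5]
      repeat refine ⟨by omega, ?_⟩
      refine ⟨⟨?_, ?_, ?_, ?_, ?_, ?_, ?_, ?_⟩, ?_, ?_, ?_, ?_, ?_⟩ <;> simp [write, *]
      intro a ha
      simp [show a ≠ 3 by omega, show a ≠ 11 by omega, show a ≠ 20 by omega, show a ≠ 21 by omega,
        show a ≠ 22 by omega, show a ≠ 23 by omega, hz a ha])
  exact ⟨s', hr, ⟨_, hq, hf'⟩, by rw [hq.idx, hq.rows]⟩

theorem runs_count (hL : Large m n B) (hM : ∀ i j, entry M i j ≤ 2) {s : ℕ → ℕ} {j k : ℕ}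
    (hs : ∀ a, s a ≤ B) (h : SeedState m n 0 j k 0 s) :
    ∃ s' flag, Runs program M B (m * 14) 28 s 42 s' ∧ SeedState m n m j k flag s' ∧ flag ≤ m ∧
      (0 < flag ↔ ∃ f < m, entry M 0 f = 1 ∧ entry M j f = 1 ∧ entry M k f = 1) := by
  obtain ⟨l1, l2, l3, l4, l5⟩ := hL.linear
  refine Exists.elim (runs_loop (P := program) (M := M) (B := B) (T := 13) (pc := 28)
    (q := 41) (a := 3) (b := 2) (N := m)
    (I := fun t s => ∃ flag, SeedState m n t j k flag s ∧ flag ≤ t ∧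
      (0 < flag ↔ ∃ f < t, entry M 0 f = 1 ∧ entry M j f = 1 ∧ entry M k f = 1))
    hL.rows_pos rfl ?_ hs ⟨0, h, le_rfl, by simp⟩) ?_
  swap
  · rintro s' ⟨hr, k, h1, h2⟩
    exact ⟨s', k, hr, h1, h2⟩
  rintro t ht s hs ⟨fl, ⟨⟨b0, b1, b2, b5, b6, b7, b8, b9⟩, h3, h10, h11, h12, hz⟩, hfl, hf⟩
  have hp1 : entry M 0 t * (2 - entry M 0 t) ≤ 1 := mul_two_sub_le
  have hp2 : entry M j t * (2 - entry M j t) ≤ 1 := mul_two_sub_le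
  have hp3 : entry M k t * (2 - entry M k t) ≤ 1 := mul_two_sub_le
  have hp := Nat.mul_le_mul hp1 hp2
  have hpp := Nat.mul_le_mul hp hp3
  have hx := hM 0 t
  have hy := hM j t
  have hw := hM k t
  have hnew : entry M 0 t * (2 - entry M 0 t) * (entry M j t * (2 - entry M j t)) *
      (entry M k t * (2 - entry M k t)) = 1 ↔
      entry M 0 t = 1 ∧ entry M j t = 1 ∧ entry M k t = 1 := by
    rw [mul_eq_one, mul_eq_one, mul_two_sub_eq_one_iff, mul_two_sub_eq_one_iff,
      mul_two_sub_eq_one_iff, and_assoc]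
  obtain ⟨s', hr, hq⟩ := runs_block codeCount (Q := fun s' =>
      SeedState m n (t + 1) j k (fl + entry M 0 t * (2 - entry M 0 t) *
        (entry M j t * (2 - entry M j t)) * (entry M k t * (2 - entry M k t))) s')
    (P := program) (M := M) (B := B) (pc := 28) ⟨_, rfl⟩ hs (by
      simp [codeCount, wp, IsStraight, value, target, write, h3, h10, h11, h12, b6, b7, b5]
      repeat refine ⟨by omega, ?_⟩
      refine ⟨⟨?_, ?_, ?_, ?_, ?_, ?_, ?_, ?_⟩, ?_, ?_, ?_, ?_, ?_⟩ <;> simp [write, *]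
      intro a ha
      simp [show a ≠ 3 by omega, show a ≠ 12 by omega, show a ≠ 20 by omega, show a ≠ 21 by omega,
        show a ≠ 22 by omega, show a ≠ 23 by omega, hz a ha])
  refine ⟨s', hr, ⟨_, hq, by omega, ?_⟩, by rw [hq.idx, hq.rows]⟩
  constructor
  · intro hpos
    by_cases h0 : 0 < fl
    · obtain ⟨f, hf1, hf2⟩ := hf.1 h0
      exact ⟨f, by omega, hf2⟩
    · exact ⟨t, by omega, hnew.1 (by omega)⟩
  · rintro ⟨f, hf1, hf2⟩
    rcases Nat.lt_succ_iff_lt_or_eq.1 hf1 with hlt | rfl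
    · have := hf.2 ⟨f, hlt, hf2⟩
      omega
    · have := hnew.2 hf2
      omega

end Scans

section Columns

variable {m n B : ℕ} {M : Matrix (Fin m) (Fin m) ℕ}

/-- The seed column computed from the rows `0`, `j`, `k`. -/
def seedCol {m : ℕ} (M : Matrix (Fin m) (Fin m) ℕ) (j k flag f : ℕ) : ℕ :=
  1 - (1 - entry M 0 f * entry M j f * (flag * entry M k f + (1 - flag) * (2 - entry M k f)))

/-- Two entries of a row-major array with rows of length `n` have the same address only if they
coincide. -/
theorem rowMajor_inj {f c g d n : ℕ} (hc : c < n) (hd : d < n) (h : f * n + c = g * n + d) :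
    f = g ∧ c = d := by
  have h1 : (c + n * f) / n = (d + n * g) / n := by
    rw [Nat.mul_comm n, Nat.mul_comm n, Nat.add_comm, h, Nat.add_comm]
  rw [Nat.add_mul_div_left _ _ (by omega), Nat.add_mul_div_left _ _ (by omega),
    Nat.div_eq_of_lt hc, Nat.div_eq_of_lt hd] at h1
  obtain rfl : f = g := by omega
  exact ⟨rfl, by omega⟩

/-- The state after `k` columns `col 0, …, col (k - 1)` have been written to the output; `S` and `L`
are the contents of the two arrays. -/
structure ColState (m n k : ℕ) (S L : ℕ → ℕ) (col : ℕ → ℕ → ℕ) (s : ℕ → ℕ) : Prop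
    extends Base m n s where
  num : s 4 = k
  arrS : ∀ f < m, s (32 + f) = S f
  arrL : ∀ f < m, s (32 + m + f) = L f
  output : ∀ f < m, ∀ c < k, s (32 + 2 * m + (f * n + c)) = col c f

theorem runs_seed (hL : Large m n B) (hM : ∀ i j, entry M i j ≤ 2) {s : ℕ → ℕ} {j k flag : ℕ}
    (hflag : flag ≤ m) (hs : ∀ a, s a ≤ B) (h : SeedState m n 0 j k flag s) :
    ∃ s', Runs program M B (m * 19 + 1) 43 s 63 s' ∧
      ColState m n 1 (seedCol M j k flag) (fun _ => 0) (fun _ => seedCol M j k flag) s' := by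
  obtain ⟨l1, l2, l3, l4, l5⟩ := hL.linear
  have hn := hL.cols_ge
  refine Exists.elim (runs_loop (P := program) (M := M) (B := B) (T := 18)
    (pc := 43) (q := 61) (a := 3) (b := 2) (N := m) (s := s)
    (I := fun t s => (Base m n s ∧ s 3 = t ∧ s 10 = j ∧ s 11 = k ∧ s 12 = flag) ∧
      (∀ f < t, s (32 + f) = seedCol M j k flag f) ∧ (∀ f < m, s (32 + m + f) = 0) ∧
      (∀ f < t, s (32 + 2 * m + f * n) = seedCol M j k flag f))
    hL.rows_pos rfl ?_ hs ⟨⟨h.toBase, h.idx, h.reg_j, h.reg_k, h.reg_flag⟩, by simp,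
      fun f _ => h.arrays _ (by omega), by simp⟩) ?_
  swap
  · rintro s' ⟨hr, ⟨b, h3, -⟩, h1, h2, h4⟩
    obtain ⟨s'', hr', hq⟩ := runs_block (P := program) (M := M) (B := B) [.const 4 1] (pc := 62)
      (Q := ColState m n 1 (seedCol M j k flag) (fun _ => 0) (fun _ => seedCol M j k flag))
      ⟨_, rfl⟩ hr.bound_final (by
        obtain ⟨b0, b1, b2, b5, b6, b7, b8, b9⟩ := b
        simp only [wp, IsStraight, value, target, true_and]
        refine ⟨by omega, ⟨?_, ?_, ?_, ?_, ?_, ?_, ?_, ?_⟩, ?_, ?_, ?_, ?_⟩ <;> simp [write, *]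
        · intro f hf
          simp [show 32 + f ≠ 4 by omega, h1 f hf]
        · intro f hf
          simp [show 32 + m + f ≠ 4 by omega, h2 f hf]
        · intro f hf
          simp [show 32 + 2 * m + f * n ≠ 4 by omega, h4 f hf])
    exact ⟨s'', hr.trans hr', hq⟩
  rintro t ht s hs ⟨⟨⟨b0, b1, b2, b5, b6, b7, b8, b9⟩, h3, h10, h11, h12⟩, h1, h2, h4⟩
  have hx := hM 0 t
  have hy := hM j t
  have hz := hM k t
  have htn : t * n ≤ m * n := Nat.mul_le_mul_right _ ht.le
  have hxy : entry M 0 t * entry M j t ≤ 2 * 2 := Nat.mul_le_mul hx hy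
  have hfz : flag * entry M k t ≤ m * 2 := Nat.mul_le_mul hflag hz
  have hfz' : (1 - flag) * (2 - entry M k t) ≤ 1 * 2 :=
    Nat.mul_le_mul (by omega) (by omega)
  have hall := Nat.mul_le_mul hxy (Nat.add_le_add hfz hfz')
  obtain ⟨s', hr, ⟨hb, g3, g10, g11, g12⟩, gA, gO, gE⟩ := runs_block codeSeed (Q := fun s' =>
      (Base m n s' ∧ s' 3 = t + 1 ∧ s' 10 = j ∧ s' 11 = k ∧ s' 12 = flag) ∧
      s' (32 + t) = seedCol M j k flag t ∧ s' (32 + 2 * m + t * n) = seedCol M j k flag t ∧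
      ∀ a, 32 ≤ a → a ≠ 32 + t → a ≠ 32 + 2 * m + t * n → s' a = s a)
    (P := program) (M := M) (B := B) (pc := 43) ⟨_, rfl⟩ hs (by
      have e1 : t * n + (32 + 2 * m) = 32 + 2 * m + t * n := by omega
      have n1 : ∀ r < 32, r ≠ 32 + t := by omega
      have n2 : ∀ r < 32, r ≠ 32 + 2 * m + t * n := by omega
      have n3 : ∀ r < 32, 32 + t ≠ r := by omega
      have n4 : ∀ r < 32, 32 + 2 * m + t * n ≠ r := by omega
      have n5 : 32 + t ≠ 32 + 2 * m + t * n := by omega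
      simp [codeSeed, wp, IsStraight, value, target, write, h3, h10, h11, h12, b6, b7, b5, b8, b0,
        b1, e1, n1, n2]
      repeat refine ⟨by omega, ?_⟩
      refine ⟨⟨?_, ?_, ?_, ?_, ?_, ?_, ?_, ?_⟩, ?_⟩
      on_goal 9 =>
        simp [n3, n4, n5, seedCol]
        intro a ha ha1 ha2
        simp [show a ≠ 3 by omega, show a ≠ 20 by omega, show a ≠ 21 by omega,
          show a ≠ 22 by omega, show a ≠ 23 by omega, show a ≠ 24 by omega, ha1, ha2]
      all_goals simp [write, *])
  refine ⟨s', hr, ⟨⟨hb, g3, g10, g11, g12⟩, fun f hf => ?_, fun f hf => ?_, fun f hf => ?_⟩,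
    by rw [g3, hb.rows]⟩
  · rcases Nat.lt_succ_iff_lt_or_eq.1 hf with hlt | rfl
    · rw [gE _ (by omega) (by omega) (by omega), h1 f hlt]
    · exact gA
  · rw [gE _ (by omega) (by omega) (by omega), h2 f hf]
  · rcases Nat.lt_succ_iff_lt_or_eq.1 hf with hlt | rfl
    · have := Nat.mul_le_mul_right n hlt
      rw [Nat.succ_mul] at this
      rw [gE _ (by omega) (by omega) (by omega), h4 f hlt]
    · exact gO

end Columns

section Rounds

variable {m n B : ℕ} {M : Matrix (Fin m) (Fin m) ℕ}

theorem runs_init (hL : Large m n B) :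
    ∃ s', Runs program M B 6 0 (init m n).mem 6 s' ∧ SeedState m n 0 0 0 0 s' := by
  obtain ⟨l1, l2, l3, l4, l5⟩ := hL.linear
  refine runs_block (P := program) (M := M) (B := B) codeInit (pc := 0)
    (Q := SeedState m n 0 0 0 0) ⟨_, rfl⟩ ?_ ?_
  · intro a
    simp only [init]
    split_ifs <;> omega
  · simp [codeInit, wp, IsStraight, value, target, write, init]
    repeat refine ⟨by omega, ?_⟩
    refine ⟨⟨?_, ?_, ?_, ?_, ?_, ?_, ?_, ?_⟩, ?_, ?_, ?_, ?_, ?_⟩ <;> simp [write]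
    · omega
    · intro a ha
      simp [show a ≠ 0 by omega, show a ≠ 1 by omega, show a ≠ 2 by omega, show a ≠ 5 by omega,
        show a ≠ 7 by omega, show a ≠ 8 by omega, show a ≠ 9 by omega]

/-- Resetting the loop counter between the phases of the search for the seed. -/
theorem runs_reset (hL : Large m n B) {s : ℕ → ℕ} {t j k flag pc : ℕ} (hs : ∀ a, s a ≤ B)
    (h : SeedState m n t j k flag s) (hP : [Instr.const 3 0] <+: program.drop pc) :
    ∃ s', Runs program M B 1 pc s (pc + 1) s' ∧ SeedState m n 0 j k flag s' := by
  obtain ⟨l1, l2, l3, l4, l5⟩ := hL.linear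
  refine runs_block (P := program) (M := M) (B := B) [.const 3 0] hP hs ?_
  obtain ⟨⟨b0, b1, b2, b5, b6, b7, b8, b9⟩, h3, h10, h11, h12, hz⟩ := h
  simp only [wp, IsStraight, value, target, true_and]
  refine ⟨by omega, ⟨?_, ?_, ?_, ?_, ?_, ?_, ?_, ?_⟩, ?_, ?_, ?_, ?_, ?_⟩ <;> simp [write, *]
  intro a ha
  simp [show a ≠ 3 by omega, hz a ha]

/-- The search for the seed, and the computation of the first column. -/
theorem runs_first (hL : Large m n B) (hM : ∀ i j, entry M i j ≤ 2) :
    ∃ s' j k flag, Runs program M B (70 * m) 0 (init m n).mem 63 s' ∧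
      ColState m n 1 (seedCol M j k flag) (fun _ => 0) (fun _ => seedCol M j k flag) s' ∧
      Found (fun f => entry M 0 f * (2 - entry M 0 f)) m j ∧
      Found (fun f => entry M 0 f * (2 - entry M 0 f) * (entry M j f * (2 - entry M j f))) m k ∧
      (0 < flag ↔ ∃ f < m, entry M 0 f = 1 ∧ entry M j f = 1 ∧ entry M k f = 1) := by
  have hm := hL.rows_pos
  obtain ⟨s1, r1, h1⟩ := runs_init (M := M) hL
  obtain ⟨s2, j, r2, h2, hj⟩ := runs_findJ hL hM r1.bound_final h1
  obtain ⟨s3, r3, h3⟩ := runs_reset (M := M) hL r2.bound_final h2 (pc := 14) ⟨_, rfl⟩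
  obtain ⟨s4, k, r4, h4, hk⟩ := runs_findK hL hM r3.bound_final h3
  obtain ⟨s5, r5, h5⟩ := runs_reset (M := M) hL r4.bound_final h4 (pc := 27) ⟨_, rfl⟩
  obtain ⟨s6, flag, r6, h6, hfm, hflag⟩ := runs_count hL hM r5.bound_final h5
  obtain ⟨s7, r7, h7⟩ := runs_reset (M := M) hL r6.bound_final h6 (pc := 42) ⟨_, rfl⟩
  obtain ⟨s8, r8, h8⟩ := runs_seed hL hM hfm r7.bound_final h7
  refine ⟨s8, j, k, flag, ?_, h8, hj, hk, hflag⟩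
  have r := r1.trans (r2.trans (r3.trans (r4.trans (r5.trans (r6.trans (r7.trans r8))))))
  exact r.mono (by omega)

theorem write_apply (s : ℕ → ℕ) (d v a : ℕ) : write s d v a = if a = d then v else s a := rfl

/-- Cell `3` and the cells `10, …, 31` are working registers: writing there preserves the state. -/
theorem ColState.write {s : ℕ → ℕ} {k : ℕ} {S L : ℕ → ℕ} {col : ℕ → ℕ → ℕ}
    (h : ColState m n k S L col s) {d : ℕ} (v : ℕ) (hd : d = 3 ∨ 10 ≤ d ∧ d < 32) :
    ColState m n k S L col (write s d v) := by
  have key : ∀ a, (a < 10 ∧ a ≠ 3) ∨ 32 ≤ a → InstaHide.write s d v a = s a := fun a ha => by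
    rw [write_apply, if_neg (by omega)]
  obtain ⟨⟨b0, b1, b2, b5, b6, b7, b8, b9⟩, h4, hS, hLL, hO⟩ := h
  refine ⟨⟨?_, ?_, ?_, ?_, ?_, ?_, ?_, ?_⟩, ?_, fun f hf => ?_, fun f hf => ?_,
    fun f hf c hc => ?_⟩ <;> rw [key _ (by omega)]
  exacts [b0, b1, b2, b5, b6, b7, b8, b9, h4, hS f hf, hLL f hf, hO f hf c hc]

theorem runs_findEdge (hL : Large m n B) {s : ℕ → ℕ} {k : ℕ} {S L : ℕ → ℕ} {col : ℕ → ℕ → ℕ}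
    (hs : ∀ a, s a ≤ B) (h : ColState m n k S L col s) :
    ∃ s' i, Runs program M B (m * 9 + 2) 63 s 74 s' ∧ ColState m n k S L col s' ∧ s' 13 = i ∧
      i ≤ m ∧ ((∃ f < m, S f = 1) → i < m ∧ S i = 1) := by
  obtain ⟨l1, l2, l3, l4, l5⟩ := hL.linear
  -- `S` is truncated outside the array, so that an index found is an index into the array.
  set p : ℕ → ℕ := fun f => if f < m then S f * (2 - S f) else 0 with hp
  have hp1 : ∀ f, p f ≤ 1 := fun f => by
    simp only [hp]
    split_ifs
    exacts [mul_two_sub_le, by omega]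
  obtain ⟨s1, hr1, hc1, h1⟩ := runs_block (P := program) (M := M) (B := B)
    [.const 3 0, .const 13 0] (pc := 63) (s := s)
    (Q := fun s => ColState m n k S L col s ∧ s 3 = 0 ∧ s 13 = 0) ⟨_, rfl⟩ hs (by
      simp only [wp, IsStraight, value, target, true_and]
      exact ⟨by omega, by omega, (h.write _ (by omega)).write _ (by omega), rfl, rfl⟩)
  refine Exists.elim (runs_loop (P := program) (M := M) (B := B) (T := 8) (pc := 65)
    (q := 73) (a := 3) (b := 2) (N := m)
    (I := fun t s => ∃ i, ColState m n k S L col s ∧ s 3 = t ∧ s 13 = i ∧ Found p t i)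
    hL.rows_pos rfl ?_ hr1.bound_final ⟨0, hc1, h1.1, h1.2, Found.zero _⟩) ?_
  swap
  · rintro s' ⟨hr, i, hc, h3, h13, hf⟩
    refine ⟨s', i, (hr1.trans hr).mono (by simp; omega), hc, h13, hf.1, fun ⟨f, hfm, hSf⟩ => ?_⟩
    have := hf.2 ⟨f, hfm, by simp [hp, hfm, hSf]⟩
    simp only [hp] at this
    split_ifs at this with him
    exact ⟨him, mul_two_sub_eq_one_iff.1 this⟩
  rintro t ht s hs ⟨i, hc, h3, h13, hf⟩
  obtain ⟨⟨b0, b1, b2, b5, b6, b7, b8, b9⟩, h4, hS, hLL, hO⟩ := id hc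
  have hpt : p t = S t * (2 - S t) := by simp [hp, ht]
  have hf' := hf.succ (hp1 t)
  rw [hpt] at hf'
  have hi := hf.1
  have hile := hf'.1
  have hle : S t * (2 - S t) ≤ 1 := mul_two_sub_le
  have hSt := hS t ht
  have hSB : S t ≤ B := hSt ▸ hs _
  obtain ⟨s', hr, hq⟩ := runs_block codeFindEdge (Q := fun s' =>
      ColState m n k S L col s' ∧ s' 3 = t + 1 ∧ s' 13 = i + S t * (2 - S t) * (t - i))
    (P := program) (M := M) (B := B) (pc := 65) ⟨_, rfl⟩ hs (by
      simp [codeFindEdge, wp, IsStraight, value, target, write_apply, h3, h13, b8, b7, b5, hSt,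
        show 32 + t ≠ 20 by omega]
      repeat refine ⟨by omega, ?_⟩
      repeat refine ColState.write ?_ _ (by omega)
      exact hc)
  exact ⟨s', hr, ⟨_, hq.1, hq.2.1, hq.2.2, hf'⟩, by rw [hq.2.1, hq.1.rows]⟩

/-- The first half of the update of row `t`: cell `23` receives the new entry. -/
theorem runs_diff (hL : Large m n B) {s : ℕ → ℕ} {k t i u : ℕ} {S L : ℕ → ℕ} {col : ℕ → ℕ → ℕ}
    (hM : ∀ i j, entry M i j ≤ 2) (hs : ∀ a, s a ≤ B) (h : ColState m n k S L col s) (ht : t < m)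
    (h3 : s 3 = t) (h13 : s 13 = i) (h14 : s 14 = u) (hu : u ≤ 2 * (n * n) + 2) :
    ∃ s', Runs program M B 6 77 s 83 s' ∧ ColState m n k S L col s' ∧ s' 3 = t ∧ s' 13 = i ∧
      s' 14 = u ∧ s' 20 = t * n + (32 + 2 * m) ∧
      s' 23 = entry M i t - s (32 + 2 * m + (t * n + u)) ∧ ∀ a, 32 ≤ a → s' a = s a := by
  obtain ⟨l1, l2, l3, l4, l5⟩ := hL.linear
  have htn : t * n ≤ m * n := Nat.mul_le_mul_right _ ht.le
  have hx := hM i t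
  have hy := hs (32 + 2 * m + (t * n + u))
  refine runs_block (P := program) (M := M) (B := B) codeDiff (pc := 77) ⟨_, rfl⟩ hs ?_
  have e1 : t * n + (32 + 2 * m) + u = 32 + 2 * m + (t * n + u) := by omega
  have n1 : ∀ r < 32, 32 + 2 * m + (t * n + u) ≠ r := by omega
  simp [codeDiff, wp, IsStraight, value, target, write_apply, h3, h13, h14, h.out, h.cols, e1, n1]
  repeat refine ⟨by omega, ?_⟩
  refine ⟨?_, fun a ha => ?_⟩
  · repeat refine ColState.write ?_ _ (by omega)
    exact h
  · simp [show a ≠ 20 by omega, show a ≠ 21 by omega, show a ≠ 22 by omega, show a ≠ 23 by omega]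

/-- The second half of the update of row `t`: the new entry `x` is written to column `k` of the
output, and `x` and `k * x` are added to the two arrays. -/
theorem runs_update (hL : Large m n B) {s : ℕ → ℕ} {k t i u x : ℕ} (hs : ∀ a, s a ≤ B)
    (h : Base m n s) (h4 : s 4 = k) (ht : t < m) (hk : k < n) (hx : x ≤ 2)
    (h3 : s 3 = t) (h13 : s 13 = i) (h14 : s 14 = u) (h20 : s 20 = t * n + (32 + 2 * m))
    (h23 : s 23 = x) (hS : s (32 + t) ≤ 2 * n) (hLt : s (32 + m + t) ≤ 2 * (n * n)) :
    ∃ s', Runs program M B 12 83 s 95 s' ∧ Base m n s' ∧ s' 4 = k ∧ s' 3 = t + 1 ∧ s' 13 = i ∧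
      s' 14 = u ∧ s' (32 + t) = s (32 + t) + x ∧ s' (32 + m + t) = s (32 + m + t) + k * x ∧
      s' (32 + 2 * m + (t * n + k)) = x ∧
      ∀ a, 32 ≤ a → a ≠ 32 + t → a ≠ 32 + m + t → a ≠ 32 + 2 * m + (t * n + k) → s' a = s a := by
  obtain ⟨l1, l2, l3, l4, l5⟩ := hL.linear
  have htn : t * n ≤ m * n := Nat.mul_le_mul_right _ ht.le
  have hkx : k * x ≤ n * 2 := Nat.mul_le_mul hk.le hx
  refine runs_block (P := program) (M := M) (B := B) codeUpdate (pc := 83) ⟨_, rfl⟩ hs ?_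
  obtain ⟨b0, b1, b2, b5, b6, b7, b8, b9⟩ := h
  have e1 : t * n + (32 + 2 * m) + k = 32 + 2 * m + (t * n + k) := by omega
  -- With opaque names for the three addresses, `simp` decides all comparisons of addresses.
  obtain ⟨A, hA⟩ : ∃ A, A = 32 + 2 * m + (t * n + k) := ⟨_, rfl⟩
  obtain ⟨A', hA'⟩ : ∃ A', A' = 32 + m + t := ⟨_, rfl⟩
  obtain ⟨A'', hA''⟩ : ∃ A'', A'' = 32 + t := ⟨_, rfl⟩
  rw [← hA'] at hLt
  rw [← hA''] at hS
  have n1 : ∀ r < 32, A ≠ r := by omega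
  have n2 : ∀ r < 32, A' ≠ r := by omega
  have n3 : ∀ r < 32, A'' ≠ r := by omega
  have n1' : ∀ r < 32, r ≠ A := by omega
  have n2' : ∀ r < 32, r ≠ A' := by omega
  have n3' : ∀ r < 32, r ≠ A'' := by omega
  have n4 : A ≠ A' := by omega
  have n5 : A ≠ A'' := by omega
  have n6 : A' ≠ A'' := by omega
  simp [codeUpdate, wp, IsStraight, value, target, write_apply, h3, h13, h14, h20, h23, h4,
    b5, b8, b9, e1, ← hA, ← hA', ← hA'', n1, n2, n3, n1', n2', n3', n4, n5, n6, n4.symm, n5.symm,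
    n6.symm]
  repeat refine ⟨by omega, ?_⟩
  refine ⟨⟨?_, ?_, ?_, ?_, ?_, ?_, ?_, ?_⟩, fun a ha ha1 ha2 ha3 => ?_⟩
  on_goal 9 =>
    simp [ha1, ha2, ha3, show a ≠ 3 by omega, show a ≠ 20 by omega, show a ≠ 21 by omega,
      show a ≠ 22 by omega]
  all_goals simp [write_apply, n1', n2', n3', b0, b1, b2, b5, b6, b7, b8, b9]

/-- The loop that computes column `k` from row `i` of the input and column `u` of the output. If `u`
is not the number of a column already written, nothing is claimed about the new column but that
its entries are at most `2`. -/
theorem runs_newColumn (hL : Large m n B) (hM : ∀ i j, entry M i j ≤ 2) {s : ℕ → ℕ} {k i u : ℕ}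
    {S L : ℕ → ℕ} {col : ℕ → ℕ → ℕ} (hs : ∀ a, s a ≤ B) (h : ColState m n k S L col s)
    (hkn : k < n) (hS : ∀ f < m, S f ≤ 2 * k) (hLb : ∀ f < m, L f ≤ 2 * (k * n))
    (h3 : s 3 = 0) (h13 : s 13 = i) (h14 : s 14 = u) (hu : u ≤ 2 * (n * n) + 2) :
    ∃ (s' x : ℕ → ℕ), Runs program M B (m * 19) 77 s 96 s' ∧ (∀ f, x f ≤ 2) ∧
      ColState m n k (fun f => S f + x f) (fun f => L f + k * x f) col s' ∧
      (∀ f < m, s' (32 + 2 * m + (f * n + k)) = x f) ∧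
      (u < k → ∀ f < m, x f = entry M i f - col u f) := by
  have hkn' : k * n ≤ n * n := Nat.mul_le_mul_right _ hkn.le
  refine Exists.elim (runs_loop (P := program) (M := M) (B := B) (T := 18) (pc := 77)
    (q := 95) (a := 3) (b := 2) (N := m) (s := s)
    (I := fun t s => ∃ x : ℕ → ℕ, (∀ f, x f ≤ 2) ∧
      ColState m n k (fun f => S f + x f) (fun f => L f + k * x f) col s ∧
      s 3 = t ∧ s 13 = i ∧ s 14 = u ∧ (∀ f, t ≤ f → x f = 0) ∧
      (∀ f < t, s (32 + 2 * m + (f * n + k)) = x f) ∧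
      (u < k → ∀ f < t, x f = entry M i f - col u f))
    hL.rows_pos rfl ?_ hs ⟨0, by simp, h, h3, h13, h14, by simp, by simp, by simp⟩) ?_
  swap
  · rintro s' ⟨hr, x, hx, hc, -, -, -, -, ho, he⟩
    exact ⟨s', x, hr, hx, hc, ho, he⟩
  rintro t ht s hs ⟨x, hx, hc, h3, h13, h14, hx0, ho, he⟩
  obtain ⟨s1, r1, c1, h3, h13, h14, h20, h23, hsame⟩ := runs_diff hL hM hs hc ht h3 h13 h14 hu
  obtain ⟨v, hv⟩ : ∃ v, v = entry M i t - s (32 + 2 * m + (t * n + u)) := ⟨_, rfl⟩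
  have hv2 : v ≤ 2 := by
    have := hM i t
    omega
  have hxt := hx0 t le_rfl
  have hSt : s1 (32 + t) = S t := by rw [c1.arrS t ht, hxt, Nat.add_zero]
  have hLt : s1 (32 + m + t) = L t := by rw [c1.arrL t ht, hxt, Nat.mul_zero, Nat.add_zero]
  have hSb := hS t ht
  have hLb' := hLb t ht
  obtain ⟨s2, r2, b2, g4, g3, g13, g14, gS, gL, gO, gE⟩ := runs_update hL r1.bound_final c1.toBase
    c1.num ht hkn hv2 h3 h13 h14 h20 (by rw [h23, hv]) (by omega) (by omega)
  have hne : ∀ f c, c < n → f ≠ t ∨ c ≠ k →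
      32 + 2 * m + (f * n + c) ≠ 32 + 2 * m + (t * n + k) := by
    intro f c hcn hfc heq
    have := rowMajor_inj hcn hkn (Nat.add_left_cancel heq)
    omega
  have hout : ∀ f c, c < n → f ≠ t ∨ c ≠ k →
      s2 (32 + 2 * m + (f * n + c)) = s (32 + 2 * m + (f * n + c)) := by
    intro f c hcn hfc
    rw [gE _ (by omega) (by omega) (by omega) (hne f c hcn hfc), hsame _ (by omega)]
  refine ⟨s2, r1.trans r2, ⟨Function.update x t v, ?_, ⟨b2, g4, ?_, ?_, ?_⟩, g3, g13, g14, ?_, ?_,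
    ?_⟩, by rw [g3, b2.rows]⟩
  · intro f
    by_cases hft : f = t
    · subst hft; simpa using hv2
    · simpa [hft] using hx f
  · intro f hf
    by_cases hft : f = t
    · subst hft; simp [gS, hSt]
    · simp only [Function.update_of_ne hft]
      rw [gE _ (by omega) (by omega) (by omega) (by omega), c1.arrS f hf]
  · intro f hf
    by_cases hft : f = t
    · subst hft; simp [gL, hLt]
    · simp only [Function.update_of_ne hft]
      rw [gE _ (by omega) (by omega) (by omega) (by omega), c1.arrL f hf]
  · intro f hf c hck
    rw [hout f c (by omega) (by omega), hc.output f hf c hck]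
  · intro f hf
    rw [Function.update_of_ne (by omega)]
    exact hx0 f (by omega)
  · intro f hf
    by_cases hft : f = t
    · subst hft; simp [gO]
    · rw [Function.update_of_ne hft, hout f k hkn (by omega)]
      exact ho f (by omega)
  · intro huk f hf
    by_cases hft : f = t
    · subst hft; rw [Function.update_self, hv, hc.output f ht u huk]
    · rw [Function.update_of_ne hft]
      exact he huk f (by omega)

/-- One round of the main loop: an edge `i` with `S i = 1` is searched, and a new column is
computed from row `i` and column `L i`. -/
theorem runs_round (hL : Large m n B) (hM : ∀ i j, entry M i j ≤ 2) {s : ℕ → ℕ} {k : ℕ}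
    {S L : ℕ → ℕ} {col : ℕ → ℕ → ℕ} (hs : ∀ a, s a ≤ B) (h : ColState m n k S L col s)
    (hk : 1 ≤ k) (hkn : k < n) (hS : ∀ f < m, S f ≤ 2 * k) (hLb : ∀ f < m, L f ≤ 2 * (k * n))
    (hcol : ∀ c f, col c f ≤ 2) :
    ∃ (s' x : ℕ → ℕ) (i : ℕ), Runs program M B (m * 28 + 6) 63 s 97 s' ∧ (∀ f, x f ≤ 2) ∧
      ColState m n (k + 1) (fun f => S f + x f) (fun f => L f + k * x f)
        (Function.update col k x) s' ∧
      ((∃ f < m, S f = 1) → i < m ∧ S i = 1) ∧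
      (i < m → L i < k → ∀ f < m, x f = entry M i f - col (L i) f) := by
  obtain ⟨l1, l2, l3, l4, l5⟩ := hL.linear
  have hm := hL.rows_pos
  have hkn' : k * n ≤ n * n := Nat.mul_le_mul_right _ hkn.le
  obtain ⟨s1, i, r1, c1, h13, him, hi⟩ := runs_findEdge (M := M) hL hs h
  -- For `i = m` the value read is the first entry of the output instead of an entry of `L`.
  have hu : s1 (32 + m + i) ≤ 2 * (n * n) + 2 := by
    rcases him.lt_or_eq with him | rfl
    · have := hLb i him
      rw [c1.arrL i him]
      omega
    · have := c1.output 0 hm 0 hk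
      rw [show 32 + i + i = 32 + 2 * i + (0 * n + 0) by ring, this]
      have := hcol 0 0
      omega
  obtain ⟨s2, r2, c2, h3, h13, h14⟩ := runs_block (P := program) (M := M) (B := B)
    [.add 20 9 13, .load 14 20, .const 3 0] (pc := 74) (s := s1)
    (Q := fun s => ColState m n k S L col s ∧ s 3 = 0 ∧ s 13 = i ∧ s 14 = s1 (32 + m + i))
    ⟨_, rfl⟩ r1.bound_final (by
      simp [wp, IsStraight, value, target, write_apply, h13, c1.arr',
        show 32 + m + i ≠ 20 by omega]
      repeat refine ⟨by omega, ?_⟩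
      repeat refine ColState.write ?_ _ (by omega)
      exact c1)
  obtain ⟨s3, x, r3, hx, c3, ho, he⟩ := runs_newColumn hL hM r2.bound_final c2 hkn hS hLb h3 h13 h14
    hu
  obtain ⟨s4, r4, c4⟩ := runs_block (P := program) (M := M) (B := B)
    [.add 4 4 5] (pc := 96) (s := s3)
    (Q := ColState m n (k + 1) (fun f => S f + x f) (fun f => L f + k * x f)
        (Function.update col k x))
    ⟨_, rfl⟩ r3.bound_final (by
      obtain ⟨⟨b0, b1, b2, b5, b6, b7, b8, b9⟩, h4, hS', hL', hO⟩ := c3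
      simp only [wp, IsStraight, value, target, true_and]
      refine ⟨by omega, ⟨?_, ?_, ?_, ?_, ?_, ?_, ?_, ?_⟩, ?_, fun f hf => ?_, fun f hf => ?_,
        fun f hf c hc => ?_⟩
      on_goal 12 =>
        rw [write_apply, if_neg (by omega)]
        rcases Nat.lt_succ_iff_lt_or_eq.1 hc with hc | rfl
        · rw [Function.update_of_ne (by omega), hO f hf c hc]
        · rw [Function.update_self, ho f hf]
      on_goal 11 => rw [write_apply, if_neg (by omega), hL' f hf]
      on_goal 10 => rw [write_apply, if_neg (by omega), hS' f hf]
      all_goals simp [write_apply, *])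
  refine ⟨s4, x, i, ?_, hx, c4, hi, fun him hLi f hf => ?_⟩
  · have r := r1.trans (r2.trans (r3.trans r4))
    refine r.mono ?_
    simp only [List.length_cons, List.length_nil]
    omega
  · rw [c1.arrL i him] at he
    exact he hLi f hf

/-- On an input `W Wᵀ` the program halts within the bounds, and if every vertex has four neighbours
and the multigraph is connected, then the output is `W` with permuted columns. -/
theorem program_correct (hL : Large m n B) {W : Matrix (Fin m) (Fin n) ℕ} {e : ℕ → Finset (Fin n)}
    (he : IsEdgeList m e) (hW : IsIncidence W e) {T : ℕ} (hT : 200 * (m * n) ≤ T) :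
    HaltsWithin program (privGram W) n T B ∧
      (HasFourNeighbours m e → IsConn m e →
        ∃ σ : Equiv.Perm (Fin n),
          outputMatrix m n (run program (privGram W) n T) = W.submatrix id σ) := by
  have hm := hL.rows_pos
  have hn := hL.cols_ge
  have hent : ∀ i j, entry (privGram W) i j = (e i ∩ e j).card := entry_privGram he hW
  have hM : ∀ i j, entry (privGram W) i j ≤ 2 := fun i j => by
    rw [hent]
    exact (Finset.card_le_card Finset.inter_subset_left).trans (he.card_le i)
  obtain ⟨s1, j, k, flag, r1, c1, hj, hk, hflag⟩ := runs_first hL hM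
  -- In the good case, the columns written so far are those of distinct vertices `v 0, …`.
  refine Exists.elim (runs_loop (P := program) (M := privGram W) (B := B) (T := m * 28 + 6)
    (pc := 63) (q := 97) (a := 4) (b := 1) (N := n - 1) (s := s1)
    (I := fun t s => ∃ S L col, ColState m n (t + 1) S L col s ∧ (∀ f < m, S f ≤ 2 * (t + 1)) ∧
      (∀ f < m, L f ≤ 2 * ((t + 1) * n)) ∧ (∀ c f, col c f ≤ 2) ∧
      (HasFourNeighbours m e → IsConn m e → ∃ v : ℕ → Fin n, Set.InjOn v (Set.Iio (t + 1)) ∧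
        (∀ c < t + 1, ∀ f < m, col c f = inc e f (v c)) ∧
        (∀ f < m, S f = knownCount e v (t + 1) f) ∧
        ∀ f < m, L f = knownIndex e v (t + 1) f))
    (by omega) rfl ?_ r1.bound_final ?_) ?_
  · rintro t ht s hs ⟨S, L, col, hc, hS, hLb, hcol, hgood⟩
    obtain ⟨s', x, i, hr, hx, hc', hi, hxe⟩ := runs_round hL hM hs hc (by omega) (by omega) hS hLb
      hcol
    refine ⟨s', hr, ⟨_, _, _, hc', fun f hf => ?_, fun f hf => ?_, fun c f => ?_, ?_⟩,
      by rw [hc'.num, hc'.cols]; omega⟩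
    · have := hS f hf
      have := hx f
      omega
    · have h1 := hLb f hf
      have h2 : (t + 1) * x f ≤ n * 2 := Nat.mul_le_mul (by omega) (hx f)
      have h3 : (t + 1 + 1) * n = (t + 1) * n + n := by ring
      rw [h3]
      omega
    · by_cases hct : c = t + 1
      · subst hct; simpa using hx f
      · simpa [hct] using hcol c f
    · intro h4 hconn
      obtain ⟨v, hv, hvc, hvS, hvL⟩ := hgood h4 hconn
      obtain ⟨f₀, hf₀, hf₀'⟩ := exists_knownCount_eq_one hconn hv (by omega) (by omega)
      obtain ⟨him, hSi⟩ := hi ⟨f₀, hf₀, by rw [hvS f₀ hf₀, hf₀']⟩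
      rw [hvS i him] at hSi
      obtain ⟨hlt, w, hwne, hwcol⟩ := propagate he hSi
      have hxw : ∀ f < m, x f = inc e f w := by
        intro f hf
        rw [hxe him (by rw [hvL i him]; exact hlt) f hf, hvL i him, hvc _ hlt f hf, hent, hwcol]
      have hsame : ∀ c < t + 1, Function.update v (t + 1) w c = v c := fun c hc =>
        Function.update_of_ne (by omega) _ _
      refine ⟨Function.update v (t + 1) w, ?_, ?_, ?_, ?_⟩
      · intro a ha b hb hab
        simp only [Set.mem_Iio] at ha hb
        rcases Nat.lt_succ_iff_lt_or_eq.1 ha with ha | rfl <;>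
          rcases Nat.lt_succ_iff_lt_or_eq.1 hb with hb | rfl
        · rw [hsame a ha, hsame b hb] at hab
          exact hv ha hb hab
        · rw [hsame a ha, Function.update_self] at hab
          exact (hwne a ha hab).elim
        · rw [hsame b hb, Function.update_self] at hab
          exact (hwne b hb hab.symm).elim
        · rfl
      · intro c hc f hf
        rcases Nat.lt_succ_iff_lt_or_eq.1 hc with hc | rfl
        · rw [hsame c hc, Function.update_of_ne (by omega), hvc c hc f hf]
        · rw [Function.update_self, Function.update_self, hxw f hf]
      · intro f hf
        rw [knownCount, Finset.sum_range_succ, Function.update_self, hxw f hf, hvS f hf, knownCount]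
        congr 1
        exact Finset.sum_congr rfl fun c hc => by rw [hsame c (by simpa using hc)]
      · intro f hf
        rw [knownIndex, Finset.sum_range_succ, Function.update_self, hxw f hf, hvL f hf, knownIndex]
        congr 1
        exact Finset.sum_congr rfl fun c hc => by rw [hsame c (by simpa using hc)]
  · have hle : ∀ f, seedCol (privGram W) j k flag f ≤ 1 := fun f => by
      unfold seedCol; omega
    refine ⟨_, _, _, c1, fun f _ => ?_, fun f _ => Nat.zero_le _, fun c f => ?_, ?_⟩
    · have := hle f
      omega
    · have := hle f
      omega
    · intro h4 hconn
      have hmul : ∀ x y : ℕ, x * (2 - x) * (y * (2 - y)) = 1 ↔ x = 1 ∧ y = 1 := fun x y => by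
        rw [mul_eq_one, mul_two_sub_eq_one_iff, mul_two_sub_eq_one_iff]
      simp only [Found, mul_two_sub_eq_one_iff, hent] at hj
      simp only [Found, hmul, hent] at hk
      simp only [hent] at hflag
      obtain ⟨v, hv⟩ := seed_column he h4 hm hj.2 hk.2 hflag
      have hvf : ∀ f < m, seedCol (privGram W) j k flag f = inc e f v := by
        intro f hf
        unfold seedCol inc
        simp only [hent]
        have := hv f hf
        split_ifs with hvf
        · have := this.1 hvf
          omega
        · have := mt this.2 hvf
          omega
      refine ⟨fun _ => v, ?_, fun c _ f hf => hvf f hf, fun f hf => ?_, fun f hf => ?_⟩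
      · intro a ha b hb _
        simp only [Set.mem_Iio] at ha hb
        omega
      · simp [knownCount, hvf f hf]
      · simp [knownIndex]
  · rintro s' ⟨hr, S, L, col, hc, -, -, -, hgood⟩
    have hlen : program.length = 98 := rfl
    have hrun : Runs program (privGram W) B T 0 (init m n).mem program.length s' := by
      rw [hlen]
      refine (r1.trans hr).mono (le_trans ?_ hT)
      obtain ⟨q, rfl⟩ : ∃ q, n = q + 1 := ⟨n - 1, by omega⟩
      have h1 : q ≤ q * m := Nat.le_mul_of_pos_right _ hm
      simp only [Nat.add_sub_cancel]
      nlinarith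
    obtain ⟨hh, hmem⟩ := hrun.haltsWithin
    refine ⟨hh, fun h4 hconn => ?_⟩
    obtain ⟨v, hv, hvc, -, -⟩ := hgood h4 hconn
    have hn1 : n - 1 + 1 = n := by omega
    rw [hn1] at hc hv hvc
    have hinj : Function.Injective (fun c : Fin n => v c) := by
      intro a b hab
      exact Fin.ext (hv a.2 b.2 hab)
    refine ⟨Equiv.ofBijective _ (Finite.injective_iff_bijective.1 hinj), ?_⟩
    ext i c
    simp only [outputMatrix, Matrix.of_apply, hmem, Matrix.submatrix_apply, id,
      Equiv.ofBijective_apply, hW i _]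
    rw [hc.out, Nat.add_assoc, hc.output i i.2 c c.2, hvc c c.2 i i.2, inc]

end Rounds

end InstaHide

theorem mainTheorem2 :
    ∃ (P : InstaHide.Program) (K : ℕ),
      (∀ (m n : ℕ) (W : Matrix (Fin m) (Fin n) ℕ), 1 ≤ m → InstaHide.IsMixup W →
        InstaHide.HaltsWithin P (InstaHide.privGram W) n (K * (m * n)) ((m * n) ^ K)) ∧
      ∀ c : ℝ, 0 < c → ∃ C : ℝ, 0 < C ∧
        ∀ m n : ℕ, 5 ≤ n → C * (n * Real.log n) ≤ m →
          1 - (n : ℝ) ^ (-c) ≤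
            (InstaHide.sampleLaw m n).real
              {w | InstaHide.Distinguishable n (InstaHide.privGram (Matrix.of w)) ∧
                ∃ W : Matrix (Fin m) (Fin n) ℕ,
                  InstaHide.outputMatrix m n
                    (InstaHide.run P (InstaHide.privGram (Matrix.of w)) n (K * (m * n))) = W ∧
                  InstaHide.IsMixup W ∧
                  InstaHide.privGram W = InstaHide.privGram (Matrix.of w)} := by
  have hlarge : ∀ m n : ℕ, 1 ≤ m → 2 ≤ n → InstaHide.Large m n ((m * n) ^ 200) := by
    intro m n hm hn
    have h2 : 2 ≤ m * n := le_trans hn (Nat.le_mul_of_pos_left n hm)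
    refine ⟨hm, hn, ?_⟩
    calc 100 * (m * n) ^ 2 ≤ 2 ^ 7 * (m * n) ^ 2 := by gcongr; norm_num
      _ ≤ (m * n) ^ 7 * (m * n) ^ 2 := by gcongr
      _ = (m * n) ^ 9 := by ring
      _ ≤ (m * n) ^ 200 := Nat.pow_le_pow_right (by omega) (by norm_num)
  refine ⟨InstaHide.program, 200, fun m n W hm hW => ?_, fun c hc => ?_⟩
  · have hn : 2 ≤ n := by
      obtain ⟨T, hT, -⟩ := hW ⟨0, hm⟩
      have := Finset.card_le_univ T
      rw [Fintype.card_fin] at this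
      omega
    obtain ⟨e, he, hWe⟩ := hW.exists_edges
    exact (InstaHide.program_correct (hlarge m n hm hn) he hWe le_rfl).1
  refine ⟨5 / 2 * (c + 6), by linarith, fun m n hn hm => ?_⟩
  have hn2 : 2 ≤ n := by omega
  have hm1 : 1 ≤ m := by
    have hnR : (5 : ℝ) ≤ n := by exact_mod_cast hn
    have hlog : 0 < Real.log n := Real.log_pos (by linarith)
    have : (0 : ℝ) < m := lt_of_lt_of_le (by positivity) hm
    exact_mod_cast this
  have := InstaHide.isProbabilityMeasure_sampleLaw m hn2
  have hbad := InstaHide.sampleLaw_not_isGood_le hc hn hm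
  refine le_trans (b := (InstaHide.sampleLaw m n).real {w | InstaHide.IsGood w}) ?_
    (MeasureTheory.measureReal_mono fun w hw => ?_)
  · have hcover := MeasureTheory.measureReal_union_le (μ := InstaHide.sampleLaw m n)
      {w | InstaHide.IsGood w} {w | ¬ InstaHide.IsGood w}
    have huniv : {w : Fin m → Fin n → ℕ | InstaHide.IsGood w} ∪ {w | ¬ InstaHide.IsGood w} =
        Set.univ := Set.union_compl_self _
    rw [huniv, MeasureTheory.probReal_univ] at hcover
    linarith
  · have hgood : InstaHide.IsGood w := hw
    obtain ⟨e, he, hWe⟩ := hgood.mixup.exists_edges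
    have h4 := hgood.hasFourNeighbours hWe
    refine ⟨InstaHide.distinguishable_of_hasFourNeighbours he hWe hgood.mixup h4, _, rfl, ?_⟩
    obtain ⟨σ, hσ⟩ := (InstaHide.program_correct (hlarge m n hm1 hn2) he hWe le_rfl).2 h4
      (hgood.isConn hWe)
    rw [hσ]
    constructor
    · intro i
      obtain ⟨T, hT, hTw⟩ := hgood.mixup i
      refine ⟨T.map σ.symm.toEmbedding, by rw [Finset.card_map, hT], ?_⟩
      funext j
      have := congrFun hTw (σ j)
      simp only [Matrix.submatrix_apply, id, this]
      congr 1
      simp [Finset.mem_map_equiv]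
    · unfold InstaHide.privGram
      rw [Matrix.transpose_submatrix, Matrix.submatrix_mul_equiv, Matrix.submatrix_id_id]
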